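/- **Theorem 1.1.** Let $A$ be a C*-algebra of nuclear dimension $m\in\mathbb{N}=\{0,1,2,\dots\}$. Let $a\in A$ be a selfadjoint element such that $\tau(a)=0$ for every bounded trace $\tau$ on $A$, i.e., for every bounded positive linear functional $\tau\colon A\to\mathbb{C}$ with $\tau(xy)=\tau(yx)$ for all $x,y\in A$. Then $a$ is a norm limit of sums $$\sum_{k=0}^{m}[x_k^*,x_k],\qquad x_k\in A,\quad \|x_k\|^2\le 2\|a\|\quad (k=0,\dots,m),$$ of $m+1$ self-commutators, where $[x^*,x]=x^*x-xx^*$. Here the nuclear dimension of $A$ is the least $m\in\mathbb{N}$ for which there exist a directed set $\Lambda$ and, for $k=0,\dots,m$ and $\lambda\in\Lambda$, finite dimensional C*-algebras $C^k_\lambda$ and completely positive contractive maps $\psi^k_\lambda\colon A\to C^k_\lambda$ and $\phi^k_\lambda\colon C^k_\lambda\to A$, such that each $\phi^k_\lambda$ has order zero (that is, $bc=0$ implies $\phi^k_\lambda(b)\phi^k_\lambda(c)=0$) and $\sum_{k=0}^m\phi^k_\lambda(\psi^k_\lambda(b))\to b$ in norm along $\Lambda$ for every $b\in A$ (and it is $\infty$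 if there is no such $m$). -/

import Mathlib

open Filter Topology
open scoped CStarAlgebra ComplexOrder

/-- A finite dimensional C*-algebra, with its canonical order (the one whose positive elements are
sums of elements `star x * x`). Every finite dimensional C*-algebra, in any universe, is isomorphic
to one with carrier in `Type`. -/
structure FinDimCStarAlgebra : Type 1 where
  carrier : Type
  [cstar : NonUnitalCStarAlgebra carrier]
  [order : PartialOrder carrier]
  [starOrdered : StarOrderedRing carrier]
  [finDim : FiniteDimensional ℂ carrier]

instance : CoeSort FinDimCStarAlgebra Type := ⟨FinDimCStarAlgebra.carrier⟩

attribute [instance] FinDimCStarAlgebra.cstar FinDimCStarAlgebra.order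
  FinDimCStarAlgebra.starOrdered FinDimCStarAlgebra.finDim

section

variable {A B : Type*} [NonUnitalCStarAlgebra A] [PartialOrder A] [StarOrderedRing A]
  [NonUnitalCStarAlgebra B] [PartialOrder B] [StarOrderedRing B]

/-- A completely positive map is contractive (c.p.c.) if it does not increase norms. -/
def CompletelyPositiveMap.IsContractive (φ : A →CP B) : Prop :=
  ∀ a : A, ‖φ a‖ ≤ ‖a‖

/-- A c.p.c. map has order zero if it is orthogonality preserving. -/
def CompletelyPositiveMap.IsOrderZero (φ : A →CP B) : Prop :=
  φ.IsContractive ∧ ∀ a b : A, a * b = 0 → φ a * φ b = 0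

end

universe u

/-- `A` has nuclear dimension at most `m`: for `k = 0, …, m` there are nets (over a common directed
set) of c.p.c. maps `ψ k l : A → C k l` and `φ k l : C k l → A` through finite dimensional
C*-algebras `C k l`, with each `φ k l` of order zero, such that `∑ k, φ k l (ψ k l a) → a` for all
`a`. (A directed set in the universe of `A` suffices: pairs of a finite subset of `A` and a
natural number.) -/
def HasNuclearDimensionAtMost (A : Type u) [NonUnitalCStarAlgebra A] [PartialOrder A]
    [StarOrderedRing A] (m : ℕ) : Prop :=
  ∃ (Λ : Type u) (_ : Preorder Λ) (_ : IsDirectedOrder Λ) (_ : Nonempty Λ)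
    (C : Fin (m + 1) → Λ → FinDimCStarAlgebra)
    (ψ : ∀ k l, A →CP C k l) (φ : ∀ k l, C k l →CP A),
    (∀ k l, (ψ k l).IsContractive) ∧
    (∀ k l, (φ k l).IsOrderZero) ∧
    ∀ a : A, Tendsto (fun l => ∑ k, φ k l (ψ k l a)) atTop (𝓝 a)

/-- The nuclear dimension of `A`: the least `m` such that `A` has nuclear dimension at most `m`,
and `⊤` if there is no such `m`. -/
noncomputable def nuclearDimension (A : Type u) [NonUnitalCStarAlgebra A] [PartialOrder A]
    [StarOrderedRing A] : ℕ∞ :=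
  sInf {d : ℕ∞ | ∃ m : ℕ, d = m ∧ HasNuclearDimensionAtMost A m}

/-- A bounded trace: a bounded positive linear functional with `τ (x * y) = τ (y * x)`. -/
structure IsBoundedTrace {A : Type*} [NonUnitalCStarAlgebra A] [PartialOrder A]
    [StarOrderedRing A] (τ : A →L[ℂ] ℂ) : Prop where
  nonneg : ∀ x : A, 0 ≤ x → 0 ≤ τ x
  map_mul_comm : ∀ x y : A, τ (x * y) = τ (y * x)

/-- `A₀`: the selfadjoint elements that vanish on every bounded trace. -/
def tracialKernel (A : Type*) [NonUnitalCStarAlgebra A] [PartialOrder A]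
    [StarOrderedRing A] : Set A :=
  {a | IsSelfAdjoint a ∧ ∀ τ : A →L[ℂ] ℂ, IsBoundedTrace τ → τ a = 0}

/-!
Let `φ k l ∘ ψ k l` be the maps of an approximation of the identity witnessing the nuclear dimension.
As `a` is close to `∑ k, φ k l (ψ k l a)`, it suffices to show that each of the `m + 1` terms is
eventually close to a self-commutator of the right norm (`eventually_exists_selfCommutator`); scaling
by a factor close to one then gives the exact norm bound. Fix `k`, and drop it from the notation.

In a finite dimensional C*-algebra, a selfadjoint element is diagonalized by minimal projections. If
its trace is zero in each simple summand, it is a self-commutator `x* x - x x*`: order the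
eigenvalues in each summand such that the partial sums stay in `[0, 2M]`, where `M` bounds the
eigenvalues, and let `x` be the weighted shift whose weights are the square roots of the partial sums
(`IsMinimalPartition.exists_selfCommutator`). An order zero map `φ` satisfies
`φ x * φ y = φ (x * y) * φ 1`, and therefore takes self-commutators to limits of self-commutators
without increasing the norm (`IsOrderZeroMap.exists_selfCommutator`).

It remains to see that `ψ l a` has small trace in each simple summand of `C l`, up to an error killed
by `φ l`. The summands whose minimal projections have images of norm less than `ε` under `φ l` are
negligible (`IsOrderZeroMap.norm_map_diagonal_sq_le`). On the others, `φ l` is bounded below, in the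
sense that the product of two elements is small if that of their images is
(`IsOrderZeroMap.norm_blockUnit_mul_le`). If `x` and `y` are orthogonal positive elements of `A`, the
elements `φ l (ψ l x)` and `φ l (ψ l y)` are dominated by elements converging to `x` and `y`, hence
their product tends to zero (`tendsto_norm_mul_of_dominated`). So `ψ`, cut down to these summands, is
asymptotically of order zero. Such maps asymptotically satisfy `ψ (a b) ψ c = ψ a ψ (b c)`
(`IsAsymptoticallyOrderZero.tendsto_map_mul`), which implies that limits of traces pulled back along
them are bounded traces on `A` (`IsAsymptoticallyOrderZero.exists_isBoundedTrace`). As `a` vanishes on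
all bounded traces, the traces of `ψ l a` on these summands tend to zero uniformly
(`eventually_norm_blockTrace_le`).
-/

set_option linter.unusedSectionVars false

/-! ### Inequalities in C*-algebras and Schwarz maps -/

section General

variable {A B : Type*} [NonUnitalCStarAlgebra A] [PartialOrder A] [StarOrderedRing A]
  [NonUnitalCStarAlgebra B] [PartialOrder B] [StarOrderedRing B]

/-- The Cauchy–Schwarz inequality between a row and a column over a C*-algebra. -/
lemma norm_sum_mul_sq_le {ι : Type*} [Fintype ι] (u w : ι → A) :
    ‖∑ i, u i * w i‖ ^ 2 ≤ ‖∑ i, u i * star (u i)‖ * ‖∑ i, star (w i) * w i‖ := by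
  let U : (WithCStarModule A (ι → A)) := (WithCStarModule.equiv A (ι → A)).symm u
  let W : (WithCStarModule A (ι → A)) := (WithCStarModule.equiv A (ι → A)).symm (fun i => star (w i))
  have h := CStarModule.norm_inner_le (A := A) (WithCStarModule A (ι → A)) (x := W) (y := U)
  have h1 : inner A W U = ∑ i, u i * w i := by
    rw [WithCStarModule.pi_inner]
    refine Finset.sum_congr rfl fun i _ => ?_
    rw [WithCStarModule.inner_def]
    simp [U, W]
  have h2 : ‖U‖ ^ 2 = ‖∑ i, u i * star (u i)‖ := by
    rw [WithCStarModule.pi_norm_sq]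
    rfl
  have h3 : ‖W‖ ^ 2 = ‖∑ i, star (w i) * w i‖ := by
    rw [WithCStarModule.pi_norm_sq]
    congr 1
    refine Finset.sum_congr rfl fun i _ => ?_
    rw [WithCStarModule.inner_def]
    simp [W]
  rw [h1] at h
  calc ‖∑ i, u i * w i‖ ^ 2 ≤ (‖W‖ * ‖U‖) ^ 2 := by gcongr
    _ = _ := by rw [mul_pow, h2, h3, mul_comm]

/-- The quadratic form `v* M v` of a positive matrix is positive. -/
lemma CStarMatrix.sum_star_mul_mul_nonneg {ι : Type*} [Fintype ι] {M : CStarMatrix ι ι A}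
    (hM : 0 ≤ M) (v : ι → A) : 0 ≤ ∑ i, ∑ j, star (v i) * M i j * v j := by
  rw [StarOrderedRing.nonneg_iff] at hM
  induction hM using AddSubmonoid.closure_induction with
  | mem M hM =>
    obtain ⟨N, rfl⟩ := hM
    have : ∑ i, ∑ j, star (v i) * (star N * N) i j * v j
        = ∑ k, star (∑ i, N k i * v i) * ∑ j, N k j * v j := by
      simp only [CStarMatrix.mul_apply, CStarMatrix.star_apply, star_sum, star_mul,
        Finset.sum_mul, Finset.mul_sum, mul_assoc]
      rw [Finset.sum_comm, Finset.sum_congr rfl fun i _ => Finset.sum_comm, Finset.sum_comm]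
    rw [this]
    exact Finset.sum_nonneg fun k _ => star_mul_self_nonneg _
  | zero => simp
  | add M N _ _ hM hN =>
    simpa only [CStarMatrix.add_apply, mul_add, add_mul, Finset.sum_add_distrib]
      using add_nonneg hM hN

/-- A positive contraction satisfying the Kadison–Schwarz inequality `ψ(x)* ψ(x) ≤ ψ(x* x)`. This is
all that is used of completely positive contractions below. -/
structure IsSchwarzMap (ψ : A →ₗ[ℂ] B) : Prop where
  nonneg : ∀ x, 0 ≤ x → 0 ≤ ψ x
  map_star : ∀ x, ψ (star x) = star (ψ x)
  norm_le : ∀ x, ‖ψ x‖ ≤ ‖x‖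
  star_mul_le : ∀ x, star (ψ x) * ψ x ≤ ψ (star x * x)

/-- Positive maps are `*`-preserving, positive elements spanning a C*-algebra. -/
lemma map_star_of_nonneg (ψ : A →ₗ[ℂ] B) (h : ∀ x, 0 ≤ x → 0 ≤ ψ x) (x : A) :
    ψ (star x) = star (ψ x) := by
  have hx : x ∈ Submodule.span ℂ {a : A | 0 ≤ a} := by
    rw [CStarAlgebra.span_nonneg]; trivial
  induction hx using Submodule.span_induction with
  | mem x hx =>
    rw [(IsSelfAdjoint.of_nonneg hx).star_eq, (IsSelfAdjoint.of_nonneg (h x hx)).star_eq]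
  | zero => simp
  | add x y _ _ hx hy => simp [hx, hy]
  | smul c x _ hx => simp [hx]

/-- Completely positive contractions satisfy the Kadison–Schwarz inequality. -/
lemma CompletelyPositiveMap.IsContractive.isSchwarzMap {ψ : A →CP B} (hψ : ψ.IsContractive) :
    IsSchwarzMap (ψ : A →ₗ[ℂ] B) := by
  have hpos : ∀ x, 0 ≤ x → 0 ≤ (ψ : A →ₗ[ℂ] B) x := fun x hx => map_nonneg ψ hx
  have hcont : Continuous ψ :=
    AddMonoidHomClass.continuous_of_bound ψ 1 fun x => by simpa using hψ x
  refine ⟨hpos, map_star_of_nonneg _ hpos, hψ, fun x => ?_⟩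
  change star (ψ x) * ψ x ≤ ψ (star x * x)
  have hst : ∀ y, ψ (star y) = star (ψ y) := map_star_of_nonneg _ hpos
  have hA := CStarAlgebra.increasingApproximateUnit A
  have hB := CStarAlgebra.increasingApproximateUnit B
  -- positivity of `ψ` on the matrix `star (e, x) * (e, x)`, tested on the vector `(-ψ x * u, u)`
  have key : ∀ u : B, ∀ e : A, 0 ≤ e → ‖e‖ ≤ 1 →
      0 ≤ star (ψ x * u) * (ψ x * u) - star (ψ x * u) * ψ (e * x) * u
        - star u * ψ (star x * e) * (ψ x * u) + star u * ψ (star x * x) * u := by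
    intro u e he he1
    have hes := (IsSelfAdjoint.of_nonneg he).star_eq
    let N : CStarMatrix (Fin 2) (Fin 2) A := CStarMatrix.ofMatrix !![e, x; 0, 0]
    have h0 : 0 ≤ star N * N := star_mul_self_nonneg N
    have h1 := CStarMatrix.sum_star_mul_mul_nonneg (ψ.map_cstarMatrix_nonneg _ h0)
      ![-(ψ x * u), u]
    simp [Fin.sum_univ_two, CStarMatrix.mul_apply, CStarMatrix.star_apply, N, hes] at h1
    have h2 : star (ψ x * u) * ψ (e * e) * (ψ x * u) ≤ star (ψ x * u) * (ψ x * u) := by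
      have hee : 0 ≤ ψ (e * e) := hpos _ (by simpa [hes] using star_mul_self_nonneg e)
      have hn : ‖ψ (e * e)‖ ≤ 1 := (hψ _).trans <| (norm_mul_le _ _).trans (by
        nlinarith [norm_nonneg e])
      refine (CStarAlgebra.star_left_conjugate_le_norm_smul
        (hb := IsSelfAdjoint.of_nonneg hee)).trans ?_
      exact smul_le_of_le_one_left (star_mul_self_nonneg _) hn
    refine h1.trans (le_of_sub_nonneg ?_)
    have h3 := sub_nonneg.2 h2
    refine h3.trans (le_of_eq ?_)
    simp only [star_mul]
    noncomm_ring
  have key2 : ∀ u : B, 0 ≤ star u * (ψ (star x * x) - star (ψ x) * ψ x) * u := by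
    intro u
    have hl : Tendsto (fun e : A => ψ (e * x)) (CStarAlgebra.approximateUnit A) (𝓝 (ψ x)) :=
      (hcont.tendsto _).comp (hA.tendsto_mul_right x)
    have hr : Tendsto (fun e : A => ψ (star x * e)) (CStarAlgebra.approximateUnit A)
        (𝓝 (ψ (star x))) := (hcont.tendsto _).comp (hA.tendsto_mul_left (star x))
    have ht : Tendsto (fun e : A => star (ψ x * u) * (ψ x * u) - star (ψ x * u) * ψ (e * x) * u
        - star u * ψ (star x * e) * (ψ x * u) + star u * ψ (star x * x) * u)
        (CStarAlgebra.approximateUnit A) (𝓝 (star (ψ x * u) * (ψ x * u)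
          - star (ψ x * u) * ψ x * u - star u * ψ (star x) * (ψ x * u)
          + star u * ψ (star x * x) * u)) :=
      ((tendsto_const_nhds.sub ((hl.const_mul _).mul_const _)).sub
        ((hr.const_mul _).mul_const _)).add tendsto_const_nhds
    have := ge_of_tendsto ht (by
      filter_upwards [hA.eventually_nonneg, hA.eventually_norm] with e h1 h2 using key u e h1 h2)
    refine this.trans (le_of_eq ?_)
    rw [hst]
    simp only [star_mul]
    noncomm_ring
  set D := ψ (star x * x) - star (ψ x) * ψ x with hD
  rw [← sub_nonneg, ← hD]
  have ht : Tendsto (fun u : B => u * D * u) (CStarAlgebra.approximateUnit B) (𝓝 D) := by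
    have hb : ∀ᶠ u in CStarAlgebra.approximateUnit B, ‖u * D * u - D‖
        ≤ ‖u * D - D‖ + ‖D * u - D‖ := by
      filter_upwards [hB.eventually_norm] with u hu
      calc ‖u * D * u - D‖ = ‖(u * D - D) * u + (D * u - D)‖ := by congr 1; noncomm_ring
        _ ≤ ‖u * D - D‖ * ‖u‖ + ‖D * u - D‖ := (norm_add_le _ _).trans (by
            gcongr; exact norm_mul_le _ _)
        _ ≤ _ := by nlinarith [norm_nonneg (u * D - D)]
    rw [tendsto_iff_norm_sub_tendsto_zero]
    refine squeeze_zero' (Eventually.of_forall fun _ => norm_nonneg _) hb ?_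
    have h1 := tendsto_iff_norm_sub_tendsto_zero.1 (hB.tendsto_mul_right D)
    have h2 := tendsto_iff_norm_sub_tendsto_zero.1 (hB.tendsto_mul_left D)
    simpa using h1.add h2
  refine ge_of_tendsto ht ?_
  filter_upwards [hB.eventually_star_eq] with u hu
  have := key2 u
  rwa [hu] at this

lemma IsSchwarzMap.mul_star_le {ψ : A →ₗ[ℂ] B} (h : IsSchwarzMap ψ) (x : A) :
    ψ x * star (ψ x) ≤ ψ (x * star x) := by
  simpa [h.map_star] using h.star_mul_le (star x)

lemma IsSchwarzMap.mono {ψ : A →ₗ[ℂ] B} (h : IsSchwarzMap ψ) {x y : A} (hxy : x ≤ y) :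
    ψ x ≤ ψ y := by
  have := h.nonneg _ (sub_nonneg.2 hxy)
  rwa [map_sub, sub_nonneg] at this

/-- If `w* w` is dominated by a multiple of `h`, then `f(h)` acts on `w` almost as a unit as soon
as `t (1 - f t) ^ 2` is small on the spectrum of `h`. -/
lemma norm_sub_mul_cfcₙ_sq_le {h w : A} {M η : ℝ} (hM : 0 ≤ M) (hh : 0 ≤ h)
    (hw : star w * w ≤ M • h)
    {f : ℝ → ℝ} (hf : Continuous f) (hf0 : f 0 = 0)
    (hfη : ∀ t ∈ quasispectrum ℝ h, t * (1 - f t) ^ 2 ≤ η) :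
    ‖w - w * cfcₙ f h‖ ^ 2 ≤ M * η := by
  set k := cfcₙ f h with hk
  have hks : star k = k := (cfcₙ_predicate f h : IsSelfAdjoint k).star_eq
  have h1 : star (w - w * k) * (w - w * k) ≤ M • (h - k * h - h * k + k * h * k) := by
    have hp : 0 ≤ M • h - star w * w := sub_nonneg.2 hw
    obtain ⟨d, hd⟩ := CStarAlgebra.nonneg_iff_eq_star_mul_self.mp hp
    rw [← sub_nonneg]
    have : M • (h - k * h - h * k + k * h * k) - star (w - w * k) * (w - w * k)
        = star (d - d * k) * (d - d * k) := by
      have e : ∀ v : A, star (v - v * k) * (v - v * k)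
          = star v * v - k * (star v * v) - (star v * v) * k + k * (star v * v) * k := by
        intro v; simp only [star_sub, star_mul, hks]; noncomm_ring
      rw [e d, e w, ← hd]
      simp only [smul_sub, smul_add, mul_sub, sub_mul, mul_smul_comm, smul_mul_assoc]
      abel
    rw [this]
    exact star_mul_self_nonneg _
  have h2 : h - k * h - h * k + k * h * k = cfcₙ (fun t => t * (1 - f t) ^ 2) h := by
    have hid : cfcₙ (fun t : ℝ => t) h = h := cfcₙ_id' ℝ h
    have : (fun t : ℝ => t * (1 - f t) ^ 2)
        = fun t => t - f t * t - t * f t + f t * t * f t := by ext t; ring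
    rw [this, cfcₙ_add (fun t => t - f t * t - t * f t) (fun t => f t * t * f t) h,
      cfcₙ_sub (fun t => t - f t * t) (fun t => t * f t) h,
      cfcₙ_sub (fun t => t) (fun t => f t * t) h,
      cfcₙ_mul (fun t => f t * t) f h, cfcₙ_mul f (fun t => t) h, cfcₙ_mul (fun t => t) f h, hid]
  have h3 : ‖h - k * h - h * k + k * h * k‖ ≤ η := by
    rw [h2]
    refine norm_cfcₙ_le fun t ht => ?_
    have ht0 : 0 ≤ t := quasispectrum_nonneg_of_nonneg h hh t ht
    rw [Real.norm_of_nonneg (by positivity)]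
    exact hfη t ht
  calc ‖w - w * k‖ ^ 2 = ‖star (w - w * k) * (w - w * k)‖ := by
        rw [CStarRing.norm_star_mul_self, sq]
    _ ≤ ‖M • (h - k * h - h * k + k * h * k)‖ :=
        CStarAlgebra.norm_le_norm_of_nonneg_of_le (star_mul_self_nonneg _) h1
    _ ≤ M * η := by
        rw [norm_smul, Real.norm_of_nonneg hM]; gcongr

/-- If a positive element nearly annihilates `u`, so does every positive element below it. -/
lemma norm_mul_sq_le_of_le {p X : A} (hp : 0 ≤ p) (hpX : p ≤ X) (u : A) :
    ‖p * u‖ ^ 2 ≤ ‖p‖ * (‖u‖ * ‖X * u‖) := by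
  have hps := (IsSelfAdjoint.of_nonneg hp).star_eq
  obtain ⟨d, rfl⟩ := CStarAlgebra.nonneg_iff_eq_star_mul_self.mp hp
  have h1 : ‖d * u‖ ^ 2 ≤ ‖u‖ * ‖X * u‖ := by
    rw [sq, ← CStarRing.norm_star_mul_self]
    have : star (d * u) * (d * u) ≤ star u * X * u := by
      have := star_left_conjugate_le_conjugate hpX u
      simpa [mul_assoc] using this
    refine (CStarAlgebra.norm_le_norm_of_nonneg_of_le (star_mul_self_nonneg _) this).trans ?_
    rw [mul_assoc]
    refine (norm_mul_le _ _).trans ?_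
    rw [norm_star]
  calc ‖star d * d * u‖ ^ 2 ≤ (‖d‖ * ‖d * u‖) ^ 2 := by
        gcongr; rw [mul_assoc]; exact (norm_mul_le _ _).trans (by rw [norm_star])
    _ = ‖d‖ ^ 2 * ‖d * u‖ ^ 2 := mul_pow _ _ _
    _ ≤ _ := by rw [CStarRing.norm_star_mul_self, ← sq]; gcongr

end General

/-! ### Minimal projections in finite dimensional C*-algebras -/

section FiniteDimensional

variable {C : Type*} [NonUnitalCStarAlgebra C] [PartialOrder C] [StarOrderedRing C]

/-- A limit point of an approximate unit is a unit. -/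
lemma exists_unit_of_finiteDimensional (C : Type*) [NonUnitalCStarAlgebra C] [PartialOrder C]
    [StarOrderedRing C] [FiniteDimensional ℂ C] :
    ∃ u : C, star u = u ∧ (∀ x, u * x = x) ∧ ∀ x, x * u = x := by
  have hC := CStarAlgebra.increasingApproximateUnit C
  have : ProperSpace C := FiniteDimensional.proper ℂ C
  let U := Ultrafilter.of (CStarAlgebra.approximateUnit C)
  have hU : (U : Filter C) ≤ CStarAlgebra.approximateUnit C := Ultrafilter.of_le _
  obtain ⟨u, -, hu⟩ := (isCompact_closedBall (0 : C) 1).ultrafilter_le_nhds U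
    (le_principal_iff.2 (hU hC.closedBall_mem))
  have hu' : Tendsto id (U : Filter C) (𝓝 u) := hu
  have h1 : ∀ x, u * x = x := fun x =>
    tendsto_nhds_unique (hu'.mul_const x) ((hC.tendsto_mul_right x).mono_left hU)
  have h2 : ∀ x, x * u = x := fun x =>
    tendsto_nhds_unique (hu'.const_mul x) ((hC.tendsto_mul_left x).mono_left hU)
  refine ⟨u, ?_, h1, h2⟩
  have h3 : star (u * star u) = star (star u) := congrArg star (h1 (star u))
  rw [star_mul, star_star, h1] at h3
  exact h3

lemma quasispectrum_finite_of_finiteDimensional [FiniteDimensional ℂ C] (d : C) :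
    (quasispectrum ℝ d).Finite := by
  have : FiniteDimensional ℝ C := FiniteDimensional.complexToReal C
  have : FiniteDimensional ℝ (Unitization ℝ C) :=
    Module.Finite.equiv (Unitization.linearEquiv ℝ ℝ C).symm
  rw [Unitization.quasispectrum_eq_spectrum_inr]
  set x : Unitization ℝ C := (d : Unitization ℝ C)
  have hi : IsIntegral ℝ x := Algebra.IsIntegral.isIntegral x
  refine ((minpoly ℝ x).rootSet_finite ℝ).subset fun t ht => ?_
  rw [Polynomial.mem_rootSet]
  refine ⟨minpoly.ne_zero hi, ?_⟩
  have h := spectrum.subset_polynomial_aeval x (minpoly ℝ x) ⟨t, ht, rfl⟩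
  rw [minpoly.aeval] at h
  simpa using h

/-- A nonzero point of the spectrum of a selfadjoint element of a finite dimensional C*-algebra has
a spectral projection. -/
lemma exists_spectral_projection [FiniteDimensional ℂ C] {d : C} (hd : star d = d) {t : ℝ}
    (ht : t ∈ quasispectrum ℝ d) (ht0 : t ≠ 0) :
    ∃ q : C, star q = q ∧ q * q = q ∧ q ≠ 0 ∧ d * q = t • q ∧ q * d = t • q ∧
      ∀ x, Commute d x → Commute q x := by
  have hds : IsSelfAdjoint d := hd
  have hfin := quasispectrum_finite_of_finiteDimensional d
  let f : ℝ → ℝ := fun s => if s = t then 1 else 0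
  have hf : ContinuousOn f (quasispectrum ℝ d) := hfin.continuousOn f
  have hf0 : f 0 = 0 := by simp [f, ht0.symm]
  have hid : cfcₙ (fun s : ℝ => s) d = d := cfcₙ_id' ℝ d
  refine ⟨cfcₙ f d, (cfcₙ_predicate f d : IsSelfAdjoint _), ?_, ?_, ?_, ?_, fun x hx =>
    hx.cfcₙ_real f⟩
  · rw [← cfcₙ_mul f f d]
    congr 1; ext s; simp [f]
  · intro h
    have := (cfcₙ_eq_cfcₙ_iff_eqOn (R := ℝ) (f := f) (g := fun _ => 0) (a := d)).1
      (by rw [h, cfcₙ_const_zero]) ht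
    simp [f] at this
  · rw [← cfcₙ_const_mul t f d]
    nth_rw 1 [← hid]
    rw [← cfcₙ_mul (fun s => s) f d]
    congr 1; ext s; by_cases h : s = t <;> simp [f, h]
  · rw [← cfcₙ_const_mul t f d]
    nth_rw 2 [← hid]
    rw [← cfcₙ_mul f (fun s => s) d]
    congr 1; ext s; by_cases h : s = t <;> simp [f, h]

/-- A finite family of pairwise orthogonal projections `p i` with sum `P` which are minimal, in the
sense that each corner `p i * C * p i` consists of scalar multiples of `p i ≠ 0`. -/
structure IsMinimalPartition {ι : Type*} [Fintype ι] (p : ι → C) (P : C) : Prop where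
  star_eq : ∀ i, star (p i) = p i
  mul_self : ∀ i, p i * p i = p i
  mul_of_ne : ∀ i j, i ≠ j → p i * p j = 0
  ne_zero : ∀ i, p i ≠ 0
  minimal : ∀ i x, ∃ z : ℂ, p i * x * p i = z • p i
  sum_eq : ∑ i, p i = P

namespace IsMinimalPartition

variable {ι : Type*} [Fintype ι] {p : ι → C} {P : C}

lemma mul_sum_of_mem (h : IsMinimalPartition p P) {T : Finset ι} {i : ι} (hi : i ∈ T) :
    p i * ∑ j ∈ T, p j = p i := by
  rw [Finset.mul_sum, Finset.sum_eq_single i, h.mul_self]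
  · exact fun j _ hj => h.mul_of_ne i j hj.symm
  · exact fun h => (h hi).elim

lemma mul_sum_of_notMem (h : IsMinimalPartition p P) {T : Finset ι} {i : ι} (hi : i ∉ T) :
    p i * ∑ j ∈ T, p j = 0 := by
  rw [Finset.mul_sum]
  exact Finset.sum_eq_zero fun j hj => h.mul_of_ne i j fun e => hi (e ▸ hj)

lemma star_sum (h : IsMinimalPartition p P) (T : Finset ι) :
    star (∑ j ∈ T, p j) = ∑ j ∈ T, p j := by
  rw [_root_.star_sum]; exact Finset.sum_congr rfl fun i _ => h.star_eq i

lemma sum_mul_of_mem (h : IsMinimalPartition p P) {T : Finset ι} {i : ι} (hi : i ∈ T) :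
    (∑ j ∈ T, p j) * p i = p i := by
  have := congrArg star (h.mul_sum_of_mem hi)
  rwa [star_mul, h.star_sum, h.star_eq] at this

lemma sum_mul_of_notMem (h : IsMinimalPartition p P) {T : Finset ι} {i : ι} (hi : i ∉ T) :
    (∑ j ∈ T, p j) * p i = 0 := by
  have := congrArg star (h.mul_sum_of_notMem hi)
  rwa [star_mul, h.star_sum, h.star_eq, star_zero] at this

lemma sum_mul_sum (h : IsMinimalPartition p P) {S T : Finset ι} (hST : S ⊆ T) :
    (∑ j ∈ S, p j) * ∑ j ∈ T, p j = ∑ j ∈ S, p j := by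
  rw [Finset.sum_mul]
  exact Finset.sum_congr rfl fun i hi => h.mul_sum_of_mem (hST hi)

lemma sum_mul_sum_of_disjoint (h : IsMinimalPartition p P) {S T : Finset ι}
    (hST : Disjoint S T) : (∑ j ∈ S, p j) * ∑ j ∈ T, p j = 0 := by
  rw [Finset.sum_mul]
  exact Finset.sum_eq_zero fun i hi => h.mul_sum_of_notMem (Finset.disjoint_left.1 hST hi)

lemma mul_total (h : IsMinimalPartition p P) (i : ι) : p i * P = p i := by
  rw [← h.sum_eq]; exact h.mul_sum_of_mem (Finset.mem_univ i)

lemma total_mul (h : IsMinimalPartition p P) (i : ι) : P * p i = p i := by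
  rw [← h.sum_eq]; exact h.sum_mul_of_mem (Finset.mem_univ i)

end IsMinimalPartition

/-- The corner `P * C * P`, as a subspace. -/
def corner (P : C) : Submodule ℂ C :=
  LinearMap.range (LinearMap.mulLeft ℂ P ∘ₗ LinearMap.mulRight ℂ P)

lemma mem_corner {P x : C} : x ∈ corner P ↔ ∃ y, P * (y * P) = x := by
  simp [corner]

lemma finrank_corner_lt [FiniteDimensional ℂ C] {P q : C} (hP : P * P = P)
    (hqq : q * q = q) (hPq : P * q = q) (hqP : q * P = q) (hne : q ≠ P) :
    Module.finrank ℂ (corner q) < Module.finrank ℂ (corner P) := by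
  refine Submodule.finrank_lt_finrank_of_lt (lt_of_le_of_ne ?_ ?_)
  · rintro _ hx
    obtain ⟨y, rfl⟩ := mem_corner.1 hx
    refine mem_corner.2 ⟨q * (y * q), ?_⟩
    calc P * (q * (y * q) * P) = (P * q) * (y * (q * P)) := by noncomm_ring
      _ = _ := by rw [hPq, hqP]
  · intro h
    have : P ∈ corner P := mem_corner.2 ⟨P, by rw [hP, hP]⟩
    rw [← h] at this
    obtain ⟨y, hy⟩ := mem_corner.1 this
    apply hne
    rw [← hqP, ← hy, ← mul_assoc, hqq]

/-- A selfadjoint element of the corner of a projection in a finite dimensional C*-algebra is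
diagonalized by a partition of the projection into minimal projections. By induction on the
dimension `n` of the corner, which is split by a spectral projection of a nonscalar selfadjoint
element commuting with the given one. -/
lemma exists_isMinimalPartition_corner [FiniteDimensional ℂ C] (n : ℕ) :
    ∀ P c : C, star P = P → P * P = P → star c = c → P * c = c → c * P = c →
      Module.finrank ℂ (corner P) = n →
      ∃ (ι : Type) (_ : Fintype ι) (p : ι → C) (μ : ι → ℝ),
        IsMinimalPartition p P ∧ c = ∑ i, μ i • p i := by
  induction n using Nat.strong_induction_on with
  | _ n ih =>
  intro P c hPs hPP hc hPc hcP hn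
  by_cases hP0 : P = 0
  · refine ⟨Empty, inferInstance, Empty.elim, Empty.elim, ⟨?_, ?_, ?_, ?_, ?_, ?_⟩, ?_⟩
    any_goals exact fun i => i.elim
    · simp [hP0]
    · simpa [hP0] using hPc.symm
  by_cases hmin : ∀ x, star x = x → ∃ r : ℝ, P * x * P = r • P
  · obtain ⟨r, hr⟩ := hmin c hc
    refine ⟨Unit, inferInstance, fun _ => P, fun _ => r, ⟨fun _ => hPs, fun _ => hPP,
      fun i j h => (h rfl).elim, fun _ => hP0, fun _ x => ?_, by simp⟩, ?_⟩
    · obtain ⟨r₁, h₁⟩ := hmin (realPart x : C) (realPart x).2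
      obtain ⟨r₂, h₂⟩ := hmin (imaginaryPart x : C) (imaginaryPart x).2
      refine ⟨r₁ + Complex.I * r₂, ?_⟩
      conv_lhs => rw [← realPart_add_I_smul_imaginaryPart x]
      rw [mul_add, add_mul, mul_smul_comm, smul_mul_assoc, h₁, h₂, add_smul, mul_smul]
      simp
    · rw [hPc, hcP] at hr
      simpa using hr
  -- a selfadjoint, nonscalar element of the corner that commutes with `c`
  obtain ⟨d, hd, hPd, hdP, hdr, hdc⟩ : ∃ d : C, star d = d ∧ P * d = d ∧ d * P = d ∧
      (∀ r : ℝ, d ≠ r • P) ∧ Commute d c := by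
    by_cases hcr : ∀ r : ℝ, c ≠ r • P
    · exact ⟨c, hc, hPc, hcP, hcr, Commute.refl c⟩
    · push Not at hcr hmin
      obtain ⟨r, rfl⟩ := hcr
      obtain ⟨x, hx, hxr⟩ := hmin
      have h1 : P * (P * x * P) = P * x * P := by rw [← mul_assoc, ← mul_assoc, hPP]
      have h2 : P * x * P * P = P * x * P := by rw [mul_assoc, hPP]
      refine ⟨P * x * P, by simp [hPs, hx, mul_assoc], h1, h2, hxr, ?_⟩
      show _ * _ = _ * _
      rw [mul_smul_comm, smul_mul_assoc, h1, h2]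
  obtain ⟨t, ht, ht0⟩ : ∃ t ∈ quasispectrum ℝ d, t ≠ 0 := by
    by_contra! hcon
    have : d = 0 := CFC.eq_zero_of_quasispectrum_eq_zero (R := ℝ) (p := IsSelfAdjoint)
      d (fun t ht => hcon t ht) hd
    exact hdr 0 (by simp [this])
  obtain ⟨q, hqs, hqq, hq0, hdq, hqd, hcomm⟩ := exists_spectral_projection hd ht ht0
  have hqP : q * P = q := by
    have : t • (q * P) = t • q := by rw [← smul_mul_assoc, ← hqd, mul_assoc, hdP]
    exact smul_right_injective C ht0 this
  have hPq : P * q = q := by simpa [hqs, hPs] using congrArg star hqP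
  have hneP : q ≠ P := by
    rintro rfl
    exact hdr t (by rw [← hdq, hdP])
  have hqc : q * c = c * q := hcomm c hdc
  obtain ⟨ι₁, _, p₁, μ₁, hp₁, hc₁⟩ := ih _ (hn ▸ finrank_corner_lt hPP hqq hPq hqP hneP) q (c * q) hqs
    hqq (by simp [hqs, hc, hqc]) (by rw [← mul_assoc, hqc, mul_assoc, hqq])
    (by rw [mul_assoc, hqq]) rfl
  set q' := P - q with hq'
  have hqq' : q * q' = 0 := by rw [hq', mul_sub, hqP, hqq, sub_self]
  have hq'q : q' * q = 0 := by rw [hq', sub_mul, hPq, hqq, sub_self]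
  have hq's : star q' = q' := by rw [hq', star_sub, hPs, hqs]
  have hq'P : q' * P = q' := by rw [hq', sub_mul, hPP, hqP]
  have hPq' : P * q' = q' := by rw [hq', mul_sub, hPP, hPq]
  have hq'q' : q' * q' = q' := by
    nth_rw 2 [hq']; rw [mul_sub, hq'P, hq'q, sub_zero]
  have hcq' : q' * c = c * q' := by rw [hq', sub_mul, mul_sub, hPc, hcP, hqc]
  obtain ⟨ι₂, _, p₂, μ₂, hp₂, hc₂⟩ := ih _ (hn ▸ finrank_corner_lt hPP hq'q' hPq' hq'P
      (by rw [hq']; simpa using hq0)) q' (c * q') hq's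
    hq'q' (by simp [hq's, hc, hcq']) (by rw [← mul_assoc, hcq', mul_assoc, hq'q'])
    (by rw [mul_assoc, hq'q']) rfl
  have h12 : ∀ i j, p₁ i * p₂ j = 0 := fun i j => by
    rw [← hp₁.mul_total i, ← hp₂.total_mul j, mul_assoc, ← mul_assoc q, hqq', zero_mul, mul_zero]
  have h21 : ∀ i j, p₂ i * p₁ j = 0 := fun i j => by
    rw [← hp₂.mul_total i, ← hp₁.total_mul j, mul_assoc, ← mul_assoc q', hq'q, zero_mul, mul_zero]
  refine ⟨ι₁ ⊕ ι₂, inferInstance, Sum.elim p₁ p₂, Sum.elim μ₁ μ₂, ⟨?_, ?_, ?_, ?_, ?_, ?_⟩, ?_⟩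
  · rintro (i | i); exacts [hp₁.star_eq i, hp₂.star_eq i]
  · rintro (i | i); exacts [hp₁.mul_self i, hp₂.mul_self i]
  · rintro (i | i) (j | j) hij
    exacts [hp₁.mul_of_ne i j (by simpa using hij), h12 i j, h21 i j,
      hp₂.mul_of_ne i j (by simpa using hij)]
  · rintro (i | i); exacts [hp₁.ne_zero i, hp₂.ne_zero i]
  · rintro (i | i) x; exacts [hp₁.minimal i x, hp₂.minimal i x]
  · simp [hp₁.sum_eq, hp₂.sum_eq, hq']
  · simp only [Fintype.sum_sum_type, Sum.elim_inl, Sum.elim_inr]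
    rw [← hc₁, ← hc₂, ← mul_add, hq', add_sub_cancel, hcP]

end FiniteDimensional

/-! ### Simple summands and their traces -/

section MinimalPartition

variable {C : Type*} [NonUnitalCStarAlgebra C] [PartialOrder C] [StarOrderedRing C]

namespace IsMinimalPartition

variable {ι : Type*} [Fintype ι] {p : ι → C} {P : C}

lemma nonneg (h : IsMinimalPartition p P) (i : ι) : 0 ≤ p i := by
  simpa [h.star_eq, h.mul_self] using star_mul_self_nonneg (p i)

lemma norm_eq_one (h : IsMinimalPartition p P) (i : ι) : ‖p i‖ = 1 := by
  have h1 := CStarRing.norm_star_mul_self (x := p i)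
  rw [h.star_eq, h.mul_self] at h1
  have h2 : ‖p i‖ ≠ 0 := norm_ne_zero_iff.2 (h.ne_zero i)
  exact (mul_left_cancel₀ h2 (by rw [mul_one]; exact h1)).symm

/-- The `i`-th diagonal entry of `x`: the scalar `z` with `p i * x * p i = z • p i`. -/
noncomputable def coeff (h : IsMinimalPartition p P) (i : ι) : C →ₗ[ℂ] ℂ where
  toFun x := (h.minimal i x).choose
  map_add' x y := by
    refine smul_left_injective ℂ (h.ne_zero i) ?_
    simp only [add_smul]
    rw [← (h.minimal i (x + y)).choose_spec, ← (h.minimal i x).choose_spec,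
      ← (h.minimal i y).choose_spec, mul_add, add_mul]
  map_smul' c x := by
    refine smul_left_injective ℂ (h.ne_zero i) ?_
    simp only [RingHom.id_apply, smul_eq_mul, mul_smul]
    rw [← (h.minimal i (c • x)).choose_spec, ← (h.minimal i x).choose_spec, mul_smul_comm,
      smul_mul_assoc]

lemma coeff_smul (h : IsMinimalPartition p P) (i : ι) (x : C) :
    h.coeff i x • p i = p i * x * p i := (h.minimal i x).choose_spec.symm

lemma coeff_eq_of (h : IsMinimalPartition p P) {i : ι} {x : C} {z : ℂ}
    (hz : p i * x * p i = z • p i) : h.coeff i x = z :=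
  smul_left_injective ℂ (h.ne_zero i) (by simp only [h.coeff_smul, hz])

lemma norm_coeff_le (h : IsMinimalPartition p P) (i : ι) (x : C) : ‖h.coeff i x‖ ≤ ‖x‖ := by
  have h1 : ‖h.coeff i x • p i‖ ≤ 1 * ‖x‖ * 1 := by
    rw [h.coeff_smul]
    exact (norm_mul_le _ _).trans (by
      rw [h.norm_eq_one]; gcongr; exact (norm_mul_le _ _).trans (by rw [h.norm_eq_one]))
  simpa [norm_smul, h.norm_eq_one] using h1

lemma coeff_nonneg (h : IsMinimalPartition p P) (i : ι) {x : C} (hx : 0 ≤ x) :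
    0 ≤ h.coeff i x := by
  set z := h.coeff i x with hz
  have h1 : 0 ≤ z • p i := by
    rw [hz, h.coeff_smul]
    simpa [h.star_eq] using star_left_conjugate_nonneg hx (p i)
  have h2 : star z • p i = z • p i := by
    simpa [h.star_eq] using (IsSelfAdjoint.of_nonneg h1).star_eq
  have h3 : star z = z := smul_left_injective ℂ (h.ne_zero i) h2
  obtain ⟨r, hr⟩ : ∃ r : ℝ, z = r := ⟨z.re, (Complex.conj_eq_iff_re.1 h3).symm⟩
  rw [hr] at h1 ⊢
  by_contra hneg
  have hr0 : r < 0 := by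
    by_contra h0; exact hneg (by simpa using not_lt.1 h0)
  have h4 : (r : ℂ) • p i ≤ 0 := by
    have : 0 ≤ (-r) • p i := smul_nonneg (by linarith) (h.nonneg i)
    rw [neg_smul, neg_nonneg] at this
    simpa using this
  have h5 := le_antisymm h4 h1
  rcases smul_eq_zero.1 h5 with h6 | h6
  · exact hr0.ne (by simpa using h6)
  · exact h.ne_zero i h6

/-- The trace property for matrix entries: with `U = p i * x * p j` and `W = p j * y * p i`, the
scalars in `U * W = a • p i` and `W * U = b • p j` agree, as `a • U = U * W * U = b • U`. -/
lemma coeff_mul_comm (h : IsMinimalPartition p P) (i j : ι) (x y : C) :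
    h.coeff i (x * p j * y) = h.coeff j (y * p i * x) := by
  set a := h.coeff i (x * p j * y) with ha
  set b := h.coeff j (y * p i * x) with hb
  set U := p i * x * p j with hU
  set W := p j * y * p i with hW
  have hUW : U * W = a • p i := by
    rw [ha, h.coeff_smul, hU, hW]
    calc p i * x * p j * (p j * y * p i) = p i * x * (p j * p j) * y * p i := by noncomm_ring
      _ = _ := by rw [h.mul_self]; noncomm_ring
  have hWU : W * U = b • p j := by
    rw [hb, h.coeff_smul, hU, hW]
    calc p j * y * p i * (p i * x * p j) = p j * y * (p i * p i) * x * p j := by noncomm_ring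
      _ = _ := by rw [h.mul_self]; noncomm_ring
  have h1 : a • U = b • U := by
    have e1 : p i * U = U := by rw [hU, ← mul_assoc, ← mul_assoc, h.mul_self]
    have e2 : U * p j = U := by rw [hU, mul_assoc, h.mul_self]
    rw [← e1, ← smul_mul_assoc, ← hUW, mul_assoc, hWU, mul_smul_comm, e2, e1]
  by_cases hU0 : U = 0
  · have h2 : a • p i = 0 := by rw [← hUW, hU0, zero_mul]
    have h3 : b • p j = 0 := by rw [← hWU, hU0, mul_zero]
    rw [(smul_eq_zero.1 h2).resolve_right (h.ne_zero i),
      (smul_eq_zero.1 h3).resolve_right (h.ne_zero j)]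
  · exact smul_left_injective ℂ hU0 h1

/-- The minimal projections `p i` and `p j` lie in the same simple summand. This is expressed by
`p i * C * p j ≠ 0`, which avoids decomposing `C` into matrix algebras. -/
def Linked (p : ι → C) (i j : ι) : Prop := ∃ x, p i * x * p j ≠ 0

lemma linked_refl (h : IsMinimalPartition p P) (i : ι) : Linked p i i :=
  ⟨p i, by rw [h.mul_self, h.mul_self]; exact h.ne_zero i⟩

lemma linked_symm (h : IsMinimalPartition p P) {i j : ι} (hij : Linked p i j) :
    Linked p j i := by
  obtain ⟨x, hx⟩ := hij
  refine ⟨star x, fun h0 => hx ?_⟩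
  have := congrArg star h0
  simpa [h.star_eq, mul_assoc] using this

/-- Linked minimal projections are Murray–von Neumann equivalent. -/
lemma exists_partialIsometry (h : IsMinimalPartition p P) {i j : ι} (hij : Linked p i j) :
    ∃ v : C, star v * v = p j ∧ v * star v = p i := by
  obtain ⟨x, hx⟩ := hij
  set w := p i * x * p j with hw
  set a := h.coeff j (star x * p i * x) with ha
  have h1 : star w * w = a • p j := by
    rw [ha, h.coeff_smul, hw]
    simp only [star_mul, h.star_eq]
    calc p j * (star x * p i) * (p i * x * p j) = p j * star x * (p i * p i) * x * p j := by
          noncomm_ring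
      _ = _ := by rw [h.mul_self]; noncomm_ring
  have h2 : w * star w = a • p i := by
    rw [ha, h.coeff_mul_comm j i, h.coeff_smul, hw]
    simp only [star_mul, h.star_eq]
    calc p i * x * p j * (p j * (star x * p i)) = p i * x * (p j * p j) * star x * p i := by
          noncomm_ring
      _ = _ := by rw [h.mul_self]; noncomm_ring
  have ha0 : 0 ≤ a := h.coeff_nonneg j (by
    have := star_left_conjugate_nonneg (h.nonneg i) x
    exact this)
  obtain ⟨r, hr0, hr⟩ : ∃ r : ℝ, 0 ≤ r ∧ a = r :=
    ⟨a.re, (Complex.le_def.1 ha0).1, (Complex.eq_re_of_ofReal_le ha0)⟩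
  have hrpos : 0 < r := by
    refine lt_of_le_of_ne hr0 fun h0 => hx ?_
    rw [hr, ← h0] at h1
    exact CStarRing.star_mul_self_eq_zero_iff w |>.1 (by simpa using h1)
  have hsq : (√r)⁻¹ * (√r)⁻¹ * r = 1 := by
    have := Real.mul_self_sqrt hr0
    have h3 : √r ≠ 0 := (Real.sqrt_pos.2 hrpos).ne'
    field_simp
    rw [sq, this]
  have key : ∀ q : C, ((√r)⁻¹ * (√r)⁻¹) • ((r : ℂ) • q) = q := fun q => by
    rw [Complex.coe_smul, smul_smul, hsq, one_smul]
  refine ⟨(√r)⁻¹ • w, ?_, ?_⟩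
  · rw [star_smul, smul_mul_smul_comm, h1, hr]; simpa using key (p j)
  · rw [star_smul, smul_mul_smul_comm, h2, hr]; simpa using key (p i)

lemma linked_trans (h : IsMinimalPartition p P) {i j k : ι} (hij : Linked p i j)
    (hjk : Linked p j k) : Linked p i k := by
  obtain ⟨v, hv1, hv2⟩ := h.exists_partialIsometry hij
  obtain ⟨w, hw1, hw2⟩ := h.exists_partialIsometry hjk
  refine ⟨v * w, fun h0 => h.ne_zero k ?_⟩
  have h1 : star w * (star v * (p i * (v * w) * p k)) = p k := by
    rw [← hv2, ← hw1]
    calc star w * (star v * (v * star v * (v * w) * (star w * w)))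
        = star w * ((star v * v) * (star v * v)) * (w * star w) * w := by noncomm_ring
      _ = star w * ((w * star w) * (w * star w)) * w := by
          rw [hv1, hw2, h.mul_self, mul_assoc (star w) (p j) (p j), h.mul_self]
      _ = star w * w * (star w * w) := by rw [hw2, h.mul_self, ← hw2]; noncomm_ring
      _ = star w * w := by rw [hw1, h.mul_self]
  rw [← h1, h0, mul_zero, mul_zero]

open Classical in
/-- The indices of the simple summand containing `p i`. -/
noncomputable def block (p : ι → C) (i : ι) : Finset ι :=
  Finset.univ.filter fun j => Linked p i j

lemma mem_block {i j : ι} : j ∈ block p i ↔ Linked p i j := by simp [block]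

lemma self_mem_block (h : IsMinimalPartition p P) (i : ι) : i ∈ block p i :=
  mem_block.2 (h.linked_refl i)

lemma block_eq (h : IsMinimalPartition p P) {i j : ι} (hij : j ∈ block p i) :
    block p j = block p i := by
  rw [mem_block] at hij
  ext k
  rw [mem_block, mem_block]
  exact ⟨fun hk => h.linked_trans hij hk, fun hk => h.linked_trans (h.linked_symm hij) hk⟩

/-- The normalized trace of the simple summand containing `p i`. -/
noncomputable def blockTrace (h : IsMinimalPartition p P) (i : ι) : C →ₗ[ℂ] ℂ :=
  ((block p i).card : ℂ)⁻¹ • ∑ j ∈ block p i, h.coeff j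

lemma blockTrace_apply (h : IsMinimalPartition p P) (i : ι) (x : C) :
    h.blockTrace i x = ((block p i).card : ℂ)⁻¹ * ∑ j ∈ block p i, h.coeff j x := by
  simp [blockTrace, LinearMap.sum_apply]

lemma card_block_pos (h : IsMinimalPartition p P) (i : ι) : 0 < (block p i).card :=
  Finset.card_pos.2 ⟨i, h.self_mem_block i⟩

lemma norm_blockTrace_le (h : IsMinimalPartition p P) (i : ι) (x : C) :
    ‖h.blockTrace i x‖ ≤ ‖x‖ := by
  rw [h.blockTrace_apply, norm_mul, norm_inv, Complex.norm_natCast]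
  have hn : (0 : ℝ) < (block p i).card := by exact_mod_cast h.card_block_pos i
  rw [inv_mul_le_iff₀ hn]
  refine (norm_sum_le _ _).trans ((Finset.sum_le_sum fun j _ => h.norm_coeff_le j x).trans ?_)
  simp

lemma blockTrace_nonneg (h : IsMinimalPartition p P) (i : ι) {x : C} (hx : 0 ≤ x) :
    0 ≤ h.blockTrace i x := by
  rw [h.blockTrace_apply]
  refine mul_nonneg ?_ (Finset.sum_nonneg fun j _ => h.coeff_nonneg j hx)
  rw [← Complex.ofReal_natCast, ← Complex.ofReal_inv]
  exact_mod_cast inv_nonneg.2 (Nat.cast_nonneg (α := ℝ) _)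

/-- Matrix multiplication, for the diagonal entries in the summand containing `p i`. -/
lemma coeff_mul (h : IsMinimalPartition p P) (hP : ∀ x, P * x = x) {i j : ι} (hj : j ∈ block p i)
    (x y : C) : h.coeff j (x * y) = ∑ k ∈ block p i, h.coeff j (x * p k * y) := by
  have h1 : x * y = ∑ k, x * p k * y := by
    rw [← Finset.sum_mul, ← Finset.mul_sum, h.sum_eq, mul_assoc, hP]
  rw [h1, map_sum]
  refine (Finset.sum_subset (Finset.subset_univ _) fun k _ hk => ?_).symm
  refine h.coeff_eq_of ?_
  have : p j * x * p k = 0 := by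
    by_contra hne
    exact hk (h.block_eq hj ▸ mem_block.2 ⟨x, hne⟩)
  rw [zero_smul, ← mul_assoc, ← mul_assoc, this, zero_mul, zero_mul]

lemma blockTrace_mul_comm (h : IsMinimalPartition p P) (hP : ∀ x, P * x = x) (i : ι) (x y : C) :
    h.blockTrace i (x * y) = h.blockTrace i (y * x) := by
  rw [h.blockTrace_apply, h.blockTrace_apply]
  congr 1
  rw [Finset.sum_congr rfl fun j hj => h.coeff_mul hP hj x y,
    Finset.sum_congr rfl fun j hj => h.coeff_mul hP hj y x, Finset.sum_comm]
  exact Finset.sum_congr rfl fun k _ => Finset.sum_congr rfl fun j _ => h.coeff_mul_comm j k x y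

/-- The unit of the simple summand containing `p i`. -/
noncomputable def blockUnit (p : ι → C) (i : ι) : C := ∑ j ∈ block p i, p j

lemma mul_blockUnit (h : IsMinimalPartition p P) (hP : ∀ x, P * x = x)
    (i : ι) (x : C) : x * blockUnit p i = ∑ j ∈ block p i, ∑ k ∈ block p i, p j * x * p k := by
  have h1 : x * blockUnit p i = ∑ j, ∑ k ∈ block p i, p j * x * p k := by
    simp_rw [← Finset.mul_sum, ← Finset.sum_mul]
    rw [h.sum_eq, hP]; rfl
  rw [h1]
  refine (Finset.sum_subset (Finset.subset_univ _) fun j _ hj => ?_).symm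
  refine Finset.sum_eq_zero fun k hk => ?_
  by_contra hne
  exact hj (mem_block.2 (h.linked_trans (mem_block.1 hk) (h.linked_symm ⟨x, hne⟩)))

/-- The unit of a simple summand is central. -/
lemma blockUnit_mul (h : IsMinimalPartition p P) (hP : ∀ x, P * x = x)
    (i : ι) (x : C) : blockUnit p i * x = x * blockUnit p i := by
  have h1 := congrArg star (h.mul_blockUnit hP i (star x))
  have h2 : star (blockUnit p i) = blockUnit p i := h.star_sum _
  rw [star_mul, star_star, h2] at h1
  rw [h1, h.mul_blockUnit hP i x]
  simp only [_root_.star_sum, star_mul, star_star, h.star_eq]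
  rw [Finset.sum_comm]
  simp only [mul_assoc]

lemma coeff_blockUnit_mul (h : IsMinimalPartition p P) {i j : ι} (hj : j ∈ block p i) (x : C) :
    h.coeff j (blockUnit p i * x) = h.coeff j x := by
  refine h.coeff_eq_of ?_
  rw [h.coeff_smul, ← mul_assoc, blockUnit, h.mul_sum_of_mem hj]

lemma blockTrace_blockUnit_mul (h : IsMinimalPartition p P) (i : ι) (x : C) :
    h.blockTrace i (blockUnit p i * x) = h.blockTrace i x := by
  rw [h.blockTrace_apply, h.blockTrace_apply]
  congr 1
  exact Finset.sum_congr rfl fun j hj => h.coeff_blockUnit_mul hj x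

lemma coeff_sum_smul (h : IsMinimalPartition p P) (μ : ι → ℝ) (j : ι) :
    h.coeff j (∑ i, μ i • p i) = μ j := by
  classical
  refine h.coeff_eq_of ?_
  rw [Finset.mul_sum, Finset.sum_mul, Finset.sum_eq_single j]
  · rw [mul_smul_comm, smul_mul_assoc, h.mul_self, h.mul_self, Complex.coe_smul]
  · intro b _ hb
    rw [mul_smul_comm, smul_mul_assoc, h.mul_of_ne j b hb.symm, zero_mul, smul_zero]
  · exact fun h => (h (Finset.mem_univ j)).elim

end IsMinimalPartition

end MinimalPartition

/-! ### Self-commutators in finite dimensional C*-algebras -/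

section SelfCommutator

variable {C : Type*} [NonUnitalCStarAlgebra C] [PartialOrder C] [StarOrderedRing C]

/-- Entries of a finite family summing to `-s` can be appended to a partial sum `s ∈ [0, 2M]`
without leaving that interval, if all entries are bounded by `M`. -/
lemma exists_partialSum_mem_Icc {ι : Type*} [DecidableEq ι] {T : Finset ι} (hT : T.Nonempty) {μ : ι → ℝ}
    {M s : ℝ} (hμ : ∀ j ∈ T, |μ j| ≤ M) (hs0 : 0 ≤ s) (hs : s ≤ 2 * M) (hsum : ∑ j ∈ T, μ j = -s) :
    ∃ j ∈ T, 0 ≤ s + μ j ∧ s + μ j ≤ 2 * M := by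
  by_cases hsM : M ≤ s
  · obtain ⟨j, hj, hj0⟩ : ∃ j ∈ T, μ j ≤ 0 := by
      by_contra! hcon
      have := Finset.sum_pos hcon hT
      linarith
    exact ⟨j, hj, by have := abs_le.1 (hμ j hj); linarith, by linarith⟩
  push Not at hsM
  by_cases hpos : ∃ j ∈ T, 0 ≤ μ j
  · obtain ⟨j, hj, hj0⟩ := hpos
    exact ⟨j, hj, by linarith, by have := abs_le.1 (hμ j hj); linarith⟩
  push Not at hpos
  -- all remaining entries are negative, so the partial sums decrease to their final value `0`
  obtain ⟨j, hj⟩ := hT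
  refine ⟨j, hj, ?_, by linarith [hpos j hj]⟩
  have h1 := Finset.add_sum_erase T μ hj
  have h2 : ∑ k ∈ T.erase j, μ k ≤ 0 :=
    Finset.sum_nonpos fun k hk => (hpos k (Finset.mem_of_mem_erase hk)).le
  linarith

namespace IsMinimalPartition

variable {ι : Type*} [Fintype ι] {p : ι → C} {P : C}

/-- A weighted shift through the minimal projections indexed by `i` and then `T`, with the squares
of the weights being the partial sums of the values `s` and `μ j` to be realized. The indices in `T`
are ordered so that the partial sums stay in `[0, 2M]`. By the last two conclusions, the shift lives
on these projections and has range under those after `p i`, which lets the induction on `T.card`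
append it to a partial isometry from `p i` to the next projection. -/
lemma exists_weightedShift (h : IsMinimalPartition p P) [DecidableEq ι] {μ : ι → ℝ} {M : ℝ}
    (n : ℕ) : ∀ (T : Finset ι) (i : ι) (s : ℝ), T.card = n → i ∉ T → (∀ j ∈ T, Linked p i j) →
      (∀ j ∈ T, |μ j| ≤ M) → 0 ≤ s → s ≤ 2 * M → ∑ j ∈ T, μ j = -s →
      ∃ x : C, star x * x - x * star x = s • p i + ∑ j ∈ T, μ j • p j ∧
        star x * x ≤ (2 * M) • (p i + ∑ j ∈ T, p j) ∧
        (∑ j ∈ T, p j) * x = x ∧ x * (p i + ∑ j ∈ T, p j) = x := by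
  induction n with
  | zero =>
    intro T i s hcard hi hlink hμ hs0 hs hsum
    obtain rfl := Finset.card_eq_zero.1 hcard
    have : s = 0 := by simpa using hsum
    subst this
    refine ⟨0, by simp, ?_, by simp, by simp⟩
    simpa using smul_nonneg hs (h.nonneg i)
  | succ n ih =>
    intro T i s hcard hi hlink hμ hs0 hs hsum
    have hT : T.Nonempty := Finset.card_pos.1 (by omega)
    obtain ⟨j, hj, hj0, hjM⟩ := exists_partialSum_mem_Icc hT hμ hs0 hs hsum
    set T' := T.erase j with hT'
    have hjT' : j ∉ T' := Finset.notMem_erase j T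
    have hsub : ∀ k ∈ T', k ∈ T := fun k hk => Finset.mem_of_mem_erase hk
    have hsum' : μ j + ∑ k ∈ T', μ k = ∑ k ∈ T, μ k := Finset.add_sum_erase T μ hj
    have hsp : p j + ∑ k ∈ T', p k = ∑ k ∈ T, p k := Finset.add_sum_erase T p hj
    have hsμp : μ j • p j + ∑ k ∈ T', μ k • p k = ∑ k ∈ T, μ k • p k :=
      Finset.add_sum_erase T (fun k => μ k • p k) hj
    obtain ⟨x, hx1, hx2, hx3, hx4⟩ := ih T' j (s + μ j) (by rw [Finset.card_erase_of_mem hj]; omega)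
      hjT' (fun k hk => h.linked_trans (h.linked_symm (hlink j hj)) (hlink k (hsub k hk)))
      (fun k hk => hμ k (hsub k hk)) hj0 hjM (by linarith)
    obtain ⟨v, hv1, hv2⟩ := h.exists_partialIsometry (h.linked_symm (hlink j hj))
    have hpv : p j * v = v := by
      have h0 : star (p j * v - v) * (p j * v - v) = 0 := by
        simp only [star_sub, star_mul, h.star_eq]
        calc (star v * p j - star v) * (p j * v - v)
            = star v * (p j * p j) * v - star v * p j * v - star v * p j * v + star v * v := by
              noncomm_ring
          _ = star v * v - star v * p j * v := by rw [h.mul_self]; abel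
          _ = 0 := by
            rw [← hv2, hv1]
            have : star v * (v * star v) * v = (star v * v) * (star v * v) := by noncomm_ring
            rw [this, hv1, h.mul_self, sub_self]
      exact sub_eq_zero.1 ((CStarRing.star_mul_self_eq_zero_iff _).1 h0)
    have hvp : v * p i = v := by
      rw [← hv1, ← mul_assoc, hv2, hpv]
    have hvx : star v * x = 0 := by
      rw [← hpv, ← hx3, star_mul, h.star_eq, mul_assoc, ← mul_assoc (p j),
        h.mul_sum_of_notMem hjT', zero_mul, mul_zero]
    have hxv : star x * v = 0 := by simpa using congrArg star hvx
    have hxv' : x * star v = 0 := by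
      rw [← hvp, ← hx4, star_mul, h.star_eq, hsp, mul_assoc, ← mul_assoc _ (p i),
        h.sum_mul_of_notMem hi, zero_mul, mul_zero]
    have hvx' : v * star x = 0 := by simpa using congrArg star hxv'
    have hsq : √s * √s = s := Real.mul_self_sqrt hs0
    have e1 : star (√s • v + x) * (√s • v + x) = s • p i + star x * x := by
      rw [star_add, star_smul, add_mul, mul_add, mul_add, smul_mul_smul_comm, smul_mul_assoc,
        mul_smul_comm, hvx, hxv, hv1]
      simp [hsq]
    have e2 : (√s • v + x) * star (√s • v + x) = s • p j + x * star x := by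
      rw [star_add, star_smul, add_mul, mul_add, mul_add, smul_mul_assoc, mul_smul_comm,
        smul_mul_assoc, mul_smul_comm, hvx', hxv', hv2, smul_smul]
      simp [hsq]
    refine ⟨√s • v + x, ?_, ?_, ?_, ?_⟩
    · rw [e1, e2, ← hsμp]
      have : star x * x = (s + μ j) • p j + ∑ k ∈ T', μ k • p k + x * star x := by
        rw [← hx1]; abel
      rw [this, add_smul]
      abel
    · rw [e1, smul_add, ← hsp]
      exact add_le_add (smul_le_smul_of_nonneg_right hs (h.nonneg i)) hx2
    · rw [← hsp, mul_add, add_mul, add_mul, hx3, mul_smul_comm, mul_smul_comm, hpv]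
      have z1 : (∑ k ∈ T', p k) * v = 0 := by
        rw [← hpv, ← mul_assoc, h.sum_mul_of_notMem hjT', zero_mul]
      have z2 : p j * x = 0 := by
        rw [← hx3, ← mul_assoc, h.mul_sum_of_notMem hjT', zero_mul]
      rw [z1, z2]; simp
    · rw [add_mul, mul_add, mul_add, smul_mul_assoc, hvp]
      have z1 : v * ∑ k ∈ T, p k = 0 := by
        rw [← hvp, mul_assoc, h.mul_sum_of_notMem hi, mul_zero]
      have z2 : x * p i = 0 := by
        rw [← hx4, hsp, mul_assoc, h.sum_mul_of_notMem hi, mul_zero]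
      have z3 : x * ∑ k ∈ T, p k = x := by rw [← hsp]; exact hx4
      rw [smul_mul_assoc, z1, z2, z3]; simp

lemma exists_selfCommutator_block (h : IsMinimalPartition p P) {μ : ι → ℝ} {M : ℝ}
    (hμ : ∀ j, |μ j| ≤ M) (i : ι) (hsum : ∑ j ∈ block p i, μ j = 0) :
    ∃ x : C, star x * x - x * star x = ∑ j ∈ block p i, μ j • p j ∧
      star x * x ≤ (2 * M) • blockUnit p i ∧
      blockUnit p i * x = x ∧ x * blockUnit p i = x := by
  classical
  obtain ⟨j, hj, hj0⟩ : ∃ j ∈ block p i, 0 ≤ μ j := by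
    by_contra! hcon
    have := Finset.sum_neg hcon ⟨i, h.self_mem_block i⟩
    linarith
  have hle := (abs_le.1 (hμ j)).2
  have hsum' := Finset.add_sum_erase (block p i) μ hj
  have hsp : p j + ∑ k ∈ (block p i).erase j, p k = blockUnit p i :=
    Finset.add_sum_erase (block p i) p hj
  obtain ⟨x, hx1, hx2, hx3, hx4⟩ := h.exists_weightedShift (μ := μ) (M := M) _
    ((block p i).erase j) j (μ j) rfl (Finset.notMem_erase j _)
    (fun k hk => mem_block.1 (by rw [h.block_eq hj]; exact Finset.mem_of_mem_erase hk))
    (fun k _ => hμ k) hj0 (by linarith) (by linarith)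
  rw [hsp] at hx2 hx4
  refine ⟨x, ?_, hx2, ?_, hx4⟩
  · rw [hx1, Finset.add_sum_erase (block p i) (fun k => μ k • p k) hj]
  · rw [← hsp, add_mul, hx3]
    have : p j * x = 0 := by
      rw [← hx3, ← mul_assoc, h.mul_sum_of_notMem (Finset.notMem_erase j _), zero_mul]
    rw [this, zero_add]

/-- The equivalence relation whose classes are the simple summands. -/
def linkedSetoid (h : IsMinimalPartition p P) : Setoid ι where
  r := Linked p
  iseqv := ⟨h.linked_refl, h.linked_symm, h.linked_trans⟩

/-- A diagonal element of trace zero in each simple summand is a self-commutator `x* x - x x*`, with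
`‖x‖ ^ 2 ≤ 2 M` if its entries are bounded by `M`. -/
lemma exists_selfCommutator (h : IsMinimalPartition p P) {μ : ι → ℝ} {M : ℝ} (hM : 0 ≤ M)
    (hμ : ∀ j, |μ j| ≤ M) (hsum : ∀ i, ∑ j ∈ block p i, μ j = 0) :
    ∃ x : C, star x * x - x * star x = ∑ j, μ j • p j ∧ ‖x‖ ^ 2 ≤ 2 * M := by
  classical
  let S := h.linkedSetoid
  let Q := Quotient S
  have : Fintype Q := Fintype.ofFinite Q
  have hblock : ∀ q : Q, block p q.out = Finset.univ.filter fun j => (⟦j⟧ : Q) = q := by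
    intro q
    ext j
    rw [mem_block, Finset.mem_filter, and_iff_right (Finset.mem_univ j), Quotient.mk_eq_iff_out]
    exact ⟨h.linked_symm, h.linked_symm⟩
  choose x hx1 hx2 hx3 hx4 using fun q : Q => h.exists_selfCommutator_block hμ q.out (hsum q.out)
  have hdisj : ∀ q r : Q, q ≠ r → blockUnit p q.out * blockUnit p r.out = 0 := by
    intro q r hqr
    refine h.sum_mul_sum_of_disjoint ?_
    rw [hblock, hblock, Finset.disjoint_filter]
    rintro j - rfl hj
    exact hqr hj
  have hstar : ∀ q : Q, star (blockUnit p q.out) = blockUnit p q.out := fun q => h.star_sum _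
  have e1 : star (∑ q, x q) * ∑ q, x q = ∑ q, star (x q) * x q := by
    rw [_root_.star_sum, Finset.sum_mul]
    refine Finset.sum_congr rfl fun q _ => ?_
    rw [Finset.mul_sum, Finset.sum_eq_single q]
    · intro r _ hr
      rw [← hx3 q, ← hx3 r, star_mul, hstar, mul_assoc, ← mul_assoc (blockUnit p q.out),
        hdisj q r hr.symm, zero_mul, mul_zero]
    · exact fun h => (h (Finset.mem_univ q)).elim
  have e2 : (∑ q, x q) * star (∑ q, x q) = ∑ q, x q * star (x q) := by
    rw [_root_.star_sum, Finset.sum_mul]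
    refine Finset.sum_congr rfl fun q _ => ?_
    rw [Finset.mul_sum, Finset.sum_eq_single q]
    · intro r _ hr
      rw [← hx4 q, ← hx4 r, star_mul, hstar, mul_assoc, ← mul_assoc (blockUnit p q.out),
        hdisj q r hr.symm, zero_mul, mul_zero]
    · exact fun h => (h (Finset.mem_univ q)).elim
  refine ⟨∑ q, x q, ?_, ?_⟩
  · rw [e1, e2, ← Finset.sum_sub_distrib, Finset.sum_congr rfl fun q _ => hx1 q]
    simp only [hblock]
    exact Finset.sum_fiberwise Finset.univ (fun j => (⟦j⟧ : Q)) fun j => μ j • p j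
  · have hle : star (∑ q, x q) * ∑ q, x q ≤ (2 * M) • ∑ j, p j := by
      rw [e1]
      refine (Finset.sum_le_sum fun q _ => hx2 q).trans (le_of_eq ?_)
      rw [← Finset.smul_sum]
      congr 1
      simp only [blockUnit, hblock]
      exact Finset.sum_fiberwise Finset.univ (fun j => (⟦j⟧ : Q)) p
    have hn : ‖∑ j, p j‖ ≤ 1 :=
      IsStarProjection.norm_le _ ⟨h.sum_mul_sum (Finset.Subset.refl _), h.star_sum _⟩
    calc ‖∑ q, x q‖ ^ 2 = ‖star (∑ q, x q) * ∑ q, x q‖ := by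
          rw [CStarRing.norm_star_mul_self, sq]
      _ ≤ ‖(2 * M) • ∑ j, p j‖ :=
          CStarAlgebra.norm_le_norm_of_nonneg_of_le (star_mul_self_nonneg _) hle
      _ ≤ 2 * M := by
          rw [norm_smul, Real.norm_of_nonneg (by positivity)]
          exact mul_le_of_le_one_right (by positivity) hn

end IsMinimalPartition

end SelfCommutator

/-! ### Order zero maps on finite dimensional C*-algebras -/

section OrderZero

variable {A C : Type*} [NonUnitalCStarAlgebra A] [PartialOrder A] [StarOrderedRing A]
  [NonUnitalCStarAlgebra C] [PartialOrder C] [StarOrderedRing C]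

lemma mul_self_le_norm_smul {g : A} (hg : 0 ≤ g) : g * g ≤ ‖g‖ • g := by
  obtain ⟨d, rfl⟩ := CStarAlgebra.nonneg_iff_eq_star_mul_self.mp hg
  have := CStarAlgebra.star_left_conjugate_le_norm_smul (a := d) (b := d * star d)
    (hb := IsSelfAdjoint.mul_star_self d)
  rw [CStarRing.norm_self_mul_star] at this
  rw [CStarRing.norm_star_mul_self]
  simpa only [mul_assoc] using this

lemma norm_mul_self_of_selfAdjoint {g : A} (hg : star g = g) : ‖g * g‖ = ‖g‖ ^ 2 := by
  have := CStarRing.norm_star_mul_self (x := g)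
  rw [hg] at this
  rw [this, sq]

lemma star_mul_self_le_norm_smul_unit {u : C} (hu : star u = u) (h1 : ∀ x, u * x = x)
    (h2 : ∀ x, x * u = x) (z : C) : star z * z ≤ ‖z‖ ^ 2 • u := by
  have := CStarAlgebra.star_left_conjugate_le_norm_smul (a := u) (b := star z * z)
    (hb := IsSelfAdjoint.star_mul_self z)
  rwa [hu, h1, h1, h2, CStarRing.norm_star_mul_self, ← sq] at this

lemma norm_unit_le {u : C} (hu : star u = u) (h1 : ∀ x, u * x = x) : ‖u‖ ≤ 1 :=
  IsStarProjection.norm_le u ⟨h1 u, hu⟩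

/-- Orthogonality preserving maps on finite dimensional C*-algebras satisfy
`φ (a * b) * φ c = φ a * φ (b * c)`: for a projection `b` both sides equal `φ (a * b) * φ (b * c)`,
and projections span. -/
lemma map_mul_mul_map_of_orderZero [FiniteDimensional ℂ C] (φ : C →ₗ[ℂ] A)
    (hφ : ∀ a b, a * b = 0 → φ a * φ b = 0) (a b c : C) : φ (a * b) * φ c = φ a * φ (b * c) := by
  obtain ⟨u, hu, hu1, hu2⟩ := exists_unit_of_finiteDimensional C
  have hproj : ∀ q : C, q * q = q → φ (a * q) * φ c = φ a * φ (q * c) := by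
    intro q hq
    have e1 : φ (a * q) * φ (c - q * c) = 0 := hφ _ _ (by
      rw [mul_sub, mul_assoc, mul_assoc, ← mul_assoc q q, hq, sub_self])
    have e2 : φ (a - a * q) * φ (q * c) = 0 := hφ _ _ (by
      rw [sub_mul, mul_assoc, ← mul_assoc q q, hq, sub_self])
    rw [map_sub, mul_sub, sub_eq_zero] at e1
    rw [map_sub, sub_mul, sub_eq_zero] at e2
    rw [e1, e2]
  have hsa : ∀ b : C, star b = b → φ (a * b) * φ c = φ a * φ (b * c) := by
    intro b hb
    obtain ⟨ι, _, p, μ, hp, rfl⟩ := exists_isMinimalPartition_corner _ u b hu (hu1 u) hb (hu1 b)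
      (hu2 b) rfl
    simp only [Finset.mul_sum, Finset.sum_mul, map_sum]
    refine Finset.sum_congr rfl fun i _ => ?_
    rw [mul_smul_comm, smul_mul_assoc, ← Complex.coe_smul, ← Complex.coe_smul, map_smul, map_smul,
      smul_mul_assoc, mul_smul_comm, hproj _ (hp.mul_self i)]
  have h1 := hsa (realPart b : C) (realPart b).2
  have h2 := hsa (imaginaryPart b : C) (imaginaryPart b).2
  rw [← realPart_add_I_smul_imaginaryPart b]
  simp only [mul_add, add_mul, map_add, mul_smul_comm, smul_mul_assoc, map_smul, h1, h2]

/-- A Schwarz map on a C*-algebra with unit `u` satisfying `φ x * φ y = φ (x * y) * φ u`, with `φ u`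
commuting with the range: these are the identities which make `φ` behave like `φ u` times
a homomorphism. -/
structure IsOrderZeroMap (φ : C →ₗ[ℂ] A) (u : C) : Prop where
  schwarz : IsSchwarzMap φ
  star_unit : star u = u
  unit_mul : ∀ x, u * x = x
  mul_unit : ∀ x, x * u = x
  map_mul : ∀ x y, φ x * φ y = φ (x * y) * φ u
  comm : ∀ x, φ x * φ u = φ u * φ x

lemma CompletelyPositiveMap.IsOrderZero.isOrderZeroMap [FiniteDimensional ℂ C] {φ : C →CP A}
    (hφ : φ.IsOrderZero) {u : C} (hu : star u = u) (h1 : ∀ x, u * x = x) (h2 : ∀ x, x * u = x) :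
    IsOrderZeroMap (φ : C →ₗ[ℂ] A) u where
  schwarz := hφ.1.isSchwarzMap
  star_unit := hu
  unit_mul := h1
  mul_unit := h2
  map_mul x y := by
    have := map_mul_mul_map_of_orderZero (φ : C →ₗ[ℂ] A) hφ.2 x y u
    rw [this, h2]
  comm x := by
    have := map_mul_mul_map_of_orderZero (φ : C →ₗ[ℂ] A) hφ.2 u x u
    rwa [h1, h2] at this

namespace IsOrderZeroMap

variable {φ : C →ₗ[ℂ] A} {u : C}

lemma unit_nonneg (h : IsOrderZeroMap φ u) : 0 ≤ φ u := by
  refine h.schwarz.nonneg _ ?_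
  have := star_mul_self_nonneg u
  rwa [h.star_unit, h.unit_mul] at this

lemma norm_unit_le (h : IsOrderZeroMap φ u) : ‖φ u‖ ≤ 1 :=
  (h.schwarz.norm_le u).trans (_root_.norm_unit_le h.star_unit h.unit_mul)

/-- The image of a self-commutator under an order zero map is a limit of self-commutators.
Heuristically `φ = φ u • π` for a homomorphism `π`, and `y = (φ u) ^ (1/2) • π x` would do; this is
`φ x * k (φ u)` with `k t = t ^ (-1/2)`, which is regularized near zero. -/
lemma exists_selfCommutator (h : IsOrderZeroMap φ u) (x : C) {ε : ℝ} (hε : 0 < ε) :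
    ∃ y : A, ‖y‖ ^ 2 ≤ ‖x‖ ^ 2 ∧
      ‖φ (star x * x - x * star x) - (star y * y - y * star y)‖ ≤ ε := by
  set z := star x * x - x * star x with hz
  obtain ⟨η, hη, hηε⟩ : ∃ η : ℝ, 0 < η ∧ ‖z‖ ^ 2 * (2 * η) ≤ ε ^ 2 := by
    refine ⟨ε ^ 2 / (2 * (‖z‖ ^ 2 + 1)), by positivity, ?_⟩
    have : ‖z‖ ^ 2 * (2 * (ε ^ 2 / (2 * (‖z‖ ^ 2 + 1)))) = ε ^ 2 * (‖z‖ ^ 2 / (‖z‖ ^ 2 + 1)) := by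
      field_simp
    rw [this]
    refine mul_le_of_le_one_right (by positivity) ?_
    rw [div_le_one (by positivity)]
    linarith
  set H := φ u with hH
  have hH0 : 0 ≤ H := h.unit_nonneg
  let k : ℝ → ℝ := fun t => √t / (|t| + η)
  have hk : Continuous k := by
    refine Real.continuous_sqrt.div (by fun_prop) fun t => ?_
    positivity
  have hk0 : k 0 = 0 := by simp [k]
  let f : ℝ → ℝ := fun t => t * (k t * k t)
  have hfc : Continuous f := by fun_prop
  have hf0 : f 0 = 0 := by simp [f]
  have hfval : ∀ t, 0 ≤ t → f t = t ^ 2 / (t + η) ^ 2 := by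
    intro t ht
    have : √t * √t = t := Real.mul_self_sqrt ht
    simp only [f, k, abs_of_nonneg ht]
    rw [div_mul_div_comm, this]
    ring
  have hf01 : ∀ t, 0 ≤ t → 0 ≤ f t ∧ f t ≤ 1 := by
    intro t ht
    rw [hfval t ht]
    refine ⟨by positivity, ?_⟩
    rw [div_le_one (by positivity)]
    gcongr
    linarith
  set K := cfcₙ k H with hK
  have hKs : star K = K := (cfcₙ_predicate k H : IsSelfAdjoint K).star_eq
  have hF : H * (K * K) = cfcₙ f H := by
    have hid : cfcₙ (fun t : ℝ => t) H = H := cfcₙ_id' ℝ H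
    rw [cfcₙ_mul (fun t => t) (fun t => k t * k t) H (hg := (hk.mul hk).continuousOn)
      (hg0 := by rw [hk0, mul_zero]), cfcₙ_mul k k H (hf := hk.continuousOn) (hf0 := hk0)
      (hg := hk.continuousOn) (hg0 := hk0), hid]
  have hKc : ∀ w, K * φ w = φ w * K := fun w =>
    (Commute.cfcₙ_real (a := H) (b := φ w) (h.comm w).symm k)
  have e1 : star (φ x * K) * (φ x * K) = φ (star x * x) * cfcₙ f H := by
    rw [star_mul, hKs, ← h.schwarz.map_star]
    calc K * φ (star x) * (φ x * K) = (K * φ (star x)) * φ x * K := by noncomm_ring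
      _ = φ (star x) * (K * φ x) * K := by rw [hKc]; noncomm_ring
      _ = (φ (star x) * φ x) * (K * K) := by rw [hKc]; noncomm_ring
      _ = _ := by rw [h.map_mul, mul_assoc, hF]
  have e2 : (φ x * K) * star (φ x * K) = φ (x * star x) * cfcₙ f H := by
    rw [star_mul, hKs, ← h.schwarz.map_star]
    calc φ x * K * (K * φ (star x)) = φ x * (K * (K * φ (star x))) := by noncomm_ring
      _ = (φ x * φ (star x)) * (K * K) := by rw [hKc, ← mul_assoc K, hKc]; noncomm_ring
      _ = _ := by rw [h.map_mul, mul_assoc, hF]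
  refine ⟨φ x * K, ?_, ?_⟩
  · rw [sq, ← CStarRing.norm_star_mul_self, e1]
    have hn : ‖cfcₙ f H‖ ≤ 1 := norm_cfcₙ_le fun t ht => by
      have := hf01 t (quasispectrum_nonneg_of_nonneg H hH0 t ht)
      rw [Real.norm_of_nonneg this.1]; exact this.2
    calc ‖φ (star x * x) * cfcₙ f H‖ ≤ ‖star x * x‖ * 1 :=
          (norm_mul_le _ _).trans (by gcongr; exact h.schwarz.norm_le _)
      _ = _ := by rw [CStarRing.norm_star_mul_self]; ring
  · rw [e1, e2, ← sub_mul, ← map_sub, ← hz]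
    refine le_of_sq_le_sq ?_ hε.le
    refine (norm_sub_mul_cfcₙ_sq_le (M := ‖z‖ ^ 2) (η := 2 * η) (by positivity) hH0 ?_ hfc hf0
      fun t ht => ?_).trans hηε
    · refine (h.schwarz.star_mul_le z).trans ?_
      have := h.schwarz.mono (star_mul_self_le_norm_smul_unit h.star_unit h.unit_mul h.mul_unit z)
      rwa [← Complex.coe_smul, map_smul, Complex.coe_smul] at this
    · have ht0 := quasispectrum_nonneg_of_nonneg H hH0 t ht
      obtain ⟨ha, hb⟩ := hf01 t ht0
      have h1 : t * (1 - f t) ≤ 2 * η := by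
        rw [hfval t ht0]
        have : t * (1 - t ^ 2 / (t + η) ^ 2) = t * (η * (2 * t + η)) / (t + η) ^ 2 := by
          field_simp; ring
        rw [this, div_le_iff₀ (by positivity)]
        nlinarith [mul_nonneg hη.le (mul_nonneg ht0 hη.le), pow_pos hη 3]
      have h2 : 0 ≤ t * (1 - f t) := mul_nonneg ht0 (by linarith)
      calc t * (1 - f t) ^ 2 = t * (1 - f t) * (1 - f t) := by ring
        _ ≤ t * (1 - f t) * 1 := by gcongr; linarith
        _ ≤ 2 * η := by linarith

/-- On diagonal elements, an order zero map is small where the coefficients or the images of the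
minimal projections are. -/
lemma norm_map_diagonal_sq_le (h : IsOrderZeroMap φ u) {ι : Type*} [Fintype ι] {p : ι → C}
    (hp : IsMinimalPartition p u) {ν : ι → ℝ} {b : ℝ} (hb : ∀ i, ν i ^ 2 * ‖φ (p i)‖ ≤ b)
    (hb0 : 0 ≤ b) : ‖φ (∑ i, ν i • p i)‖ ^ 2 ≤ b := by
  set x := ∑ i, ν i • p i with hx
  have hxs : star x = x := by
    rw [hx, star_sum]; exact Finset.sum_congr rfl fun i _ => by simp [hp.star_eq]
  have hpn : ∀ i, 0 ≤ φ (p i) := fun i => h.schwarz.nonneg _ (hp.nonneg i)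
  have hxx : x * x = ∑ i, ν i ^ 2 • p i := by
    rw [hx, Finset.sum_mul]
    refine Finset.sum_congr rfl fun i _ => ?_
    rw [Finset.mul_sum, Finset.sum_eq_single i]
    · rw [smul_mul_smul_comm, hp.mul_self, sq]
    · intro j _ hj
      rw [smul_mul_smul_comm, hp.mul_of_ne i j hj.symm, smul_zero]
    · exact fun h => (h (Finset.mem_univ i)).elim
  have hsm : ∀ (r : ℝ) (c : C), φ (r • c) = r • φ c := fun r c => by
    rw [← Complex.coe_smul, map_smul, Complex.coe_smul]
  have hle : φ x * φ x ≤ b • φ u := by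
    have hφu : φ u = ∑ i, φ (p i) := by rw [← map_sum, hp.sum_eq]
    rw [h.map_mul, hxx, map_sum, Finset.sum_mul]
    nth_rw 2 [hφu]
    rw [Finset.smul_sum]
    refine Finset.sum_le_sum fun i _ => ?_
    rw [hsm, smul_mul_assoc]
    have e : φ (p i) * φ u = φ (p i) * φ (p i) := by
      rw [h.map_mul (p i) (p i), hp.mul_self]
    rw [e]
    calc ν i ^ 2 • (φ (p i) * φ (p i)) ≤ ν i ^ 2 • (‖φ (p i)‖ • φ (p i)) :=
          smul_le_smul_of_nonneg_left (mul_self_le_norm_smul (hpn i)) (sq_nonneg _)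
      _ = (ν i ^ 2 * ‖φ (p i)‖) • φ (p i) := smul_smul _ _ _
      _ ≤ b • φ (p i) := smul_le_smul_of_nonneg_right (hb i) (hpn i)
  have hφs : star (φ x) = φ x := by rw [← h.schwarz.map_star, hxs]
  rw [← norm_mul_self_of_selfAdjoint hφs]
  have h0 : 0 ≤ φ x * φ x := by simpa [hφs] using star_mul_self_nonneg (φ x)
  calc ‖φ x * φ x‖ ≤ ‖b • φ u‖ := CStarAlgebra.norm_le_norm_of_nonneg_of_le h0 hle
    _ ≤ b := by
      rw [norm_smul, Real.norm_of_nonneg hb0]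
      exact mul_le_of_le_one_right hb0 h.norm_unit_le

/-- On a simple summand where the minimal projections have images of norm at least `ε`, an order
zero map is bounded below, in the sense that nearly orthogonal images come from nearly orthogonal
elements. For `w = c * d` and the block unit `e`, the norm of `e * w` is attained on `v = q * p j`, with
`q` the spectral projection of `(e * w)* (e * w)` for its largest eigenvalue. The norm of `φ w * φ v`
can then be computed from `w * v`, since `φ u` acts on `φ (p j)` as `φ (p j)` itself. -/
lemma norm_blockUnit_mul_le [FiniteDimensional ℂ C] (h : IsOrderZeroMap φ u) {ι : Type*}
    [Fintype ι] {p : ι → C} (hp : IsMinimalPartition p u) {ε : ℝ} (hε : 0 < ε) {i : ι}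
    (hi : ∀ j ∈ IsMinimalPartition.block p i, ε ≤ ‖φ (p j)‖) (c d : C) :
    ε ^ 3 * ‖IsMinimalPartition.blockUnit p i * (c * d)‖ ≤ ‖φ c * φ d‖ := by
  set w := c * d with hw
  set e := IsMinimalPartition.blockUnit p i with he
  rw [h.map_mul, ← hw]
  set H := φ u with hH
  have hHs : star H = H := (IsSelfAdjoint.of_nonneg h.unit_nonneg).star_eq
  have hes : star e = e := hp.star_sum _
  have hee : e * e = e := hp.sum_mul_sum (Finset.Subset.refl _)
  have hec : ∀ x, e * x = x * e := hp.blockUnit_mul h.unit_mul i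
  set b := star (e * w) * (e * w) with hb
  have hb0 : 0 ≤ b := star_mul_self_nonneg _
  have hbs : star b = b := (IsSelfAdjoint.of_nonneg hb0).star_eq
  have hbe : b = star w * w * e := by
    rw [hb, star_mul, hes]
    calc star w * e * (e * w) = star w * ((e * e) * w) := by noncomm_ring
      _ = _ := by rw [hee, hec]; noncomm_ring
  have hbnorm : ‖b‖ = ‖e * w‖ ^ 2 := by rw [hb, CStarRing.norm_star_mul_self, sq]
  by_cases hbz : b = 0
  · have : ‖e * w‖ = 0 := by
      rw [hbz, norm_zero] at hbnorm
      exact pow_eq_zero_iff two_ne_zero |>.1 hbnorm.symm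
    rw [this, mul_zero]
    exact norm_nonneg _
  -- a spectral projection `q` of `b` for the eigenvalue `‖b‖`
  obtain ⟨t, ht, htb⟩ := (NonUnitalIsometricContinuousFunctionalCalculus.isGreatest_norm_quasispectrum
    (𝕜 := ℝ) (p := IsSelfAdjoint) b hbs).1
  have ht0 : 0 ≤ t := quasispectrum_nonneg_of_nonneg b hb0 t ht
  have htb' : t = ‖b‖ := by rw [← htb]; exact (Real.norm_of_nonneg ht0).symm
  have htne : t ≠ 0 := by rw [htb']; exact norm_ne_zero_iff.2 hbz
  obtain ⟨q, hqs, hqq, hq0, hbq, hqb, -⟩ := exists_spectral_projection hbs ht htne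
  have heq : e * q = q := by
    have : t • (e * q) = t • q := by
      rw [← mul_smul_comm, ← hbq, ← mul_assoc, hec, hbe, mul_assoc (star w * w), hee]
    exact smul_right_injective C htne this
  obtain ⟨j, hj, hjq⟩ : ∃ j ∈ IsMinimalPartition.block p i, p j * q ≠ 0 := by
    by_contra! hcon
    refine hq0 ?_
    rw [← heq, he, IsMinimalPartition.blockUnit, Finset.sum_mul]
    exact Finset.sum_eq_zero hcon
  set v := q * p j with hv
  set α := hp.coeff j q with hα
  have hvv : star v * v = α • p j := by
    rw [hα, hp.coeff_smul, hv, star_mul, hqs, hp.star_eq]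
    calc p j * q * (q * p j) = p j * (q * q) * p j := by noncomm_ring
      _ = _ := by rw [hqq]
  have hα0 : α ≠ 0 := by
    intro h0
    rw [h0, zero_smul, CStarRing.star_mul_self_eq_zero_iff] at hvv
    refine hjq ?_
    have := congrArg star hvv
    simpa [hv, hqs, hp.star_eq] using this
  have hwv : star (w * v) * (w * v) = (t : ℂ) • α • p j := by
    rw [← hvv, star_mul]
    have hqv : q * v = v := by rw [hv, ← mul_assoc, hqq]
    have hev : e * v = v := by rw [hv, ← mul_assoc, heq]
    calc star v * star w * (w * v) = star v * (star w * w * v) := by noncomm_ring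
      _ = star v * (star w * w * (e * v)) := by rw [hev]
      _ = star v * (b * v) := by rw [hbe]; noncomm_ring
      _ = star v * (b * q * v) := by rw [mul_assoc b, hqv]
      _ = _ := by
        rw [hbq, smul_mul_assoc, hqv, mul_smul_comm, Complex.coe_smul]
  set g := φ (p j) with hg
  have hgs : star g = g := by rw [hg, ← h.schwarz.map_star, hp.star_eq]
  have hgH : g * H = g * g := by rw [hg, h.map_mul (p j) (p j), hp.mul_self]
  set E := φ w * H * (H * φ v) with hE
  have hE' : E = φ (w * v) * (H * (H * H)) := by
    rw [hE, ← h.comm v]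
    calc φ w * H * (φ v * H) = φ w * (H * φ v) * H := by noncomm_ring
      _ = (φ w * φ v) * H * H := by rw [← h.comm v]; noncomm_ring
      _ = _ := by rw [h.map_mul]; noncomm_ring
  have hEE : star E * E = (t : ℂ) • α • ((g * g * (g * g)) * (g * g * (g * g))) := by
    have hHHH : star (H * (H * H)) = H * H * H := by simp only [star_mul, hHs]
    rw [hE', star_mul, ← h.schwarz.map_star, hHHH]
    have hcm : ∀ x, H * H * H * φ x = φ x * (H * H * H) := fun x => by
      have hx : Commute H (φ x) := (h.comm x).symm
      exact (hx.mul_left hx).mul_left hx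
    calc H * H * H * φ (star (w * v)) * (φ (w * v) * (H * (H * H)))
        = φ (star (w * v)) * (H * H * H * φ (w * v)) * (H * (H * H)) := by rw [hcm]; noncomm_ring
      _ = (φ (star (w * v)) * φ (w * v)) * (H * H * H) * (H * (H * H)) := by
          rw [hcm]; noncomm_ring
      _ = φ ((t : ℂ) • α • p j) * H * H * H * H * H * H * H := by
          rw [h.map_mul, hwv]; noncomm_ring
      _ = (t : ℂ) • α • (g * H * H * H * H * H * H * H) := by
          simp only [map_smul, smul_mul_assoc, ← hg]
      _ = _ := by
          have r : ∀ y : A, y * g * H = y * g * g := fun y => by rw [mul_assoc, hgH, ← mul_assoc]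
          rw [hgH, r, r, r, r, r, r]; noncomm_ring
  have hgg : star (g * g) = g * g := by simp [hgs]
  have hgggg : star (g * g * (g * g)) = g * g * (g * g) := by simp [hgs, mul_assoc]
  have hnE : ‖E‖ ^ 2 = t * ‖α‖ * ‖g‖ ^ 8 := by
    rw [sq, ← CStarRing.norm_star_mul_self, hEE, norm_smul, norm_smul,
      norm_mul_self_of_selfAdjoint hgggg, norm_mul_self_of_selfAdjoint hgg,
      norm_mul_self_of_selfAdjoint hgs, Complex.norm_real, Real.norm_of_nonneg ht0]
    ring
  have hnv : ‖φ v‖ ^ 2 = ‖α‖ * ‖g‖ ^ 2 := by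
    rw [sq, ← CStarRing.norm_star_mul_self, ← h.schwarz.map_star, h.map_mul, hvv, map_smul,
      smul_mul_assoc, norm_smul, ← hg, hgH, norm_mul_self_of_selfAdjoint hgs]
  have hle : ‖E‖ ^ 2 ≤ ‖φ w * H‖ ^ 2 * ‖φ v‖ ^ 2 := by
    rw [← mul_pow]
    gcongr
    refine (norm_mul_le _ _).trans ?_
    gcongr
    refine (norm_mul_le _ _).trans ?_
    exact mul_le_of_le_one_left (norm_nonneg _) h.norm_unit_le
  have hgε : ε ≤ ‖g‖ := hi j hj
  have hgpos : 0 < ‖g‖ := hε.trans_le hgε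
  have hαpos : 0 < ‖α‖ := norm_pos_iff.2 hα0
  have hfin : t * ‖g‖ ^ 6 ≤ ‖φ w * H‖ ^ 2 := by
    rw [hnE, hnv] at hle
    have : (t * ‖g‖ ^ 6) * (‖α‖ * ‖g‖ ^ 2) ≤ ‖φ w * H‖ ^ 2 * (‖α‖ * ‖g‖ ^ 2) := by
      calc _ = t * ‖α‖ * ‖g‖ ^ 8 := by ring
        _ ≤ _ := hle
    exact le_of_mul_le_mul_right this (by positivity)
  refine le_of_sq_le_sq ?_ (norm_nonneg _)
  calc (ε ^ 3 * ‖e * w‖) ^ 2 = t * ε ^ 6 := by rw [htb', hbnorm]; ring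
    _ ≤ t * ‖g‖ ^ 6 := by gcongr
    _ ≤ _ := hfin

end IsOrderZeroMap

end OrderZero

/-! ### Asymptotically order zero maps -/

section Asymptotic

variable {A : Type*} [NonUnitalCStarAlgebra A] [PartialOrder A] [StarOrderedRing A]

/-- If `ψ (x* x)` nearly annihilates `w`, so does `ψ x`. -/
lemma IsSchwarzMap.norm_map_mul_sq_le {B : Type*} [NonUnitalCStarAlgebra B] [PartialOrder B]
    [StarOrderedRing B] {ψ : A →ₗ[ℂ] B} (h : IsSchwarzMap ψ) (x : A) (w : B) :
    ‖ψ x * w‖ ^ 2 ≤ ‖w‖ * ‖ψ (star x * x) * w‖ := by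
  have h1 : star (ψ x * w) * (ψ x * w) ≤ star w * ψ (star x * x) * w := by
    have := star_left_conjugate_le_conjugate (h.star_mul_le x) w
    simpa [mul_assoc] using this
  calc ‖ψ x * w‖ ^ 2 = ‖star (ψ x * w) * (ψ x * w)‖ := by rw [CStarRing.norm_star_mul_self, sq]
    _ ≤ ‖star w * ψ (star x * x) * w‖ :=
        CStarAlgebra.norm_le_norm_of_nonneg_of_le (star_mul_self_nonneg _) h1
    _ ≤ _ := by rw [mul_assoc]; exact (norm_mul_le _ _).trans (by rw [norm_star])

/-- A family of Schwarz maps that is asymptotically orthogonality preserving, for positive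
elements, along a filter. -/
structure IsAsymptoticallyOrderZero {Λ : Type*} (F : Filter Λ) {C : Λ → Type*}
    [∀ l, NonUnitalCStarAlgebra (C l)] [∀ l, PartialOrder (C l)] [∀ l, StarOrderedRing (C l)]
    (ψ : ∀ l, A →ₗ[ℂ] C l) : Prop where
  schwarz : ∀ l, IsSchwarzMap (ψ l)
  zero : ∀ x y : A, 0 ≤ x → 0 ≤ y → x * y = 0 →
    Tendsto (fun l => ‖ψ l x * ψ l y‖) F (𝓝 0)

/-- For `δ > 0`, the piecewise linear function which is `0` up to `i * δ` and `1` from `(i + 1) * δ`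
on. -/
noncomputable def ramp (δ : ℝ) (i : ℕ) (t : ℝ) : ℝ := max 0 (min 1 (t / δ - i))

lemma continuous_ramp (δ : ℝ) (i : ℕ) : Continuous (ramp δ i) := by
  unfold ramp; fun_prop

lemma ramp_zero (δ : ℝ) (i : ℕ) : ramp δ i 0 = 0 := by
  simp [ramp]

lemma ramp_nonneg (δ : ℝ) (i : ℕ) (t : ℝ) : 0 ≤ ramp δ i t := le_max_left _ _

lemma ramp_le_one (δ : ℝ) (i : ℕ) (t : ℝ) : ramp δ i t ≤ 1 :=
  max_le zero_le_one (min_le_left _ _)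

lemma ramp_succ_le (δ : ℝ) (i : ℕ) (t : ℝ) : ramp δ (i + 1) t ≤ ramp δ i t := by
  unfold ramp
  push_cast
  gcongr
  linarith

/-- Each ramp acts as a unit on the next. -/
lemma ramp_succ_mul (δ : ℝ) (i : ℕ) (t : ℝ) :
    ramp δ (i + 1) t * ramp δ i t = ramp δ (i + 1) t := by
  by_cases h : t / δ ≤ i + 1
  · have : ramp δ (i + 1) t = 0 := by
      unfold ramp; push_cast
      exact max_eq_left ((min_le_right _ _).trans (by linarith))
    rw [this, zero_mul]
  · push Not at h
    have : ramp δ i t = 1 := by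
      unfold ramp
      rw [min_eq_left (by linarith)]; simp
    rw [this, mul_one]

/-- A multiple of the identity is a sum of ramps, as far as `N * δ`. -/
lemma sum_ramp (δ : ℝ) {t : ℝ} (ht : 0 ≤ t / δ) (N : ℕ) :
    ∑ i ∈ Finset.range N, ramp δ i t = min (t / δ) N := by
  induction N with
  | zero => simp [ht]
  | succ N ih =>
    rw [Finset.sum_range_succ, ih, ramp]
    push_cast
    rcases le_total (t / δ) N with h | h
    · rw [min_eq_left h, max_eq_left ((min_le_right _ _).trans (by linarith)),
        min_eq_left (by linarith), add_zero]
    · rw [min_eq_right h]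
      rcases le_total (t / δ) (N + 1) with h' | h'
      · rw [min_eq_left h', min_eq_right (by linarith), max_eq_right (by linarith)]; ring
      · rw [min_eq_right h', min_eq_left (by linarith), max_eq_right zero_le_one]

lemma sum_ramp_sub_sq_le (δ : ℝ) (t : ℝ) (N : ℕ) :
    ∑ i ∈ Finset.range N, (ramp δ i t - ramp δ (i + 1) t) * (ramp δ i t - ramp δ (i + 1) t)
      ≤ 1 := by
  have h1 : ∀ i, (ramp δ i t - ramp δ (i + 1) t) * (ramp δ i t - ramp δ (i + 1) t)
      ≤ ramp δ i t - ramp δ (i + 1) t := fun i => by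
    have a1 := ramp_succ_le δ i t
    have a2 := ramp_le_one δ i t
    have a3 := ramp_nonneg δ (i + 1) t
    nlinarith
  refine (Finset.sum_le_sum fun i _ => h1 i).trans ?_
  rw [Finset.sum_range_sub' (fun i => ramp δ i t)]
  linarith [ramp_le_one δ 0 t, ramp_nonneg δ N t]

namespace IsAsymptoticallyOrderZero

variable {Λ : Type*} {F : Filter Λ} {C : Λ → Type*}
    [∀ l, NonUnitalCStarAlgebra (C l)] [∀ l, PartialOrder (C l)] [∀ l, StarOrderedRing (C l)]
    {ψ : ∀ l, A →ₗ[ℂ] C l}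

/-- The case of general elements follows by passing from `x`, `y` to `x* x`, `y y*`. -/
lemma tendsto_mul_of_mul_eq_zero (h : IsAsymptoticallyOrderZero F ψ) {x y : A}
    (hxy : x * y = 0) :
    Tendsto (fun l => ‖ψ l x * ψ l y‖) F (𝓝 0) := by
  have hz : (y * star y) * (star x * x) = 0 := by
    have : star y * star x = 0 := by rw [← star_mul, hxy, star_zero]
    calc (y * star y) * (star x * x) = y * (star y * star x) * x := by noncomm_ring
      _ = 0 := by rw [this, mul_zero, zero_mul]
  have h0 := h.zero _ _ (mul_star_self_nonneg y) (star_mul_self_nonneg x) hz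
  have hle : ∀ l, (‖ψ l x * ψ l y‖ ^ 2) ^ 2
      ≤ ‖y‖ ^ 2 * (‖star x * x‖ * ‖ψ l (y * star y) * ψ l (star x * x)‖) := by
    intro l
    have h1 := (h.schwarz l).norm_map_mul_sq_le x (ψ l y)
    have h2 := (h.schwarz l).norm_map_mul_sq_le (star y) (ψ l (star x * x))
    have h3 : ‖ψ l (star x * x) * ψ l y‖ = ‖ψ l (star y) * ψ l (star x * x)‖ := by
      rw [← norm_star, star_mul, ← (h.schwarz l).map_star, ← (h.schwarz l).map_star]
      simp
    rw [star_star] at h2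
    calc (‖ψ l x * ψ l y‖ ^ 2) ^ 2 ≤ (‖ψ l y‖ * ‖ψ l (star x * x) * ψ l y‖) ^ 2 := by gcongr
      _ = ‖ψ l y‖ ^ 2 * ‖ψ l (star y) * ψ l (star x * x)‖ ^ 2 := by rw [mul_pow, h3]
      _ ≤ ‖y‖ ^ 2 * (‖star x * x‖ * ‖ψ l (y * star y) * ψ l (star x * x)‖) := by
          gcongr
          · exact (h.schwarz l).norm_le y
          · exact h2.trans (by gcongr; exact (h.schwarz l).norm_le _)
  have h4 : Tendsto (fun l => (‖ψ l x * ψ l y‖ ^ 2) ^ 2) F (𝓝 0) := by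
    refine squeeze_zero (fun l => by positivity) hle ?_
    simpa using (h0.const_mul ‖star x * x‖).const_mul (‖y‖ ^ 2)
  have h5 := h4.sqrt.sqrt
  simpa [Real.sqrt_sq, norm_nonneg] using h5

/-- With `G i` the ramps of `b`, the elements `a * G (i + 1)` and `c - G i * c` have product zero, so
only `G i - G (i + 1)` contributes to `ψ (a * G i) * ψ (c - G i * c)` in the limit. As these
differences form a row of norm at most one, the Cauchy–Schwarz inequality shows that the sum over
`N` ramps is of order `√N` rather than `N`. -/
lemma eventually_norm_sum_ramp_le (h : IsAsymptoticallyOrderZero F ψ) (a b c : A)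
    (δ : ℝ) (N : ℕ) :
    ∀ᶠ l in F, ‖∑ i ∈ Finset.range N,
      ψ l (a * cfcₙ (ramp δ i) b) * ψ l (c - cfcₙ (ramp δ i) b * c)‖
        ≤ 2 * ‖a‖ * ‖c‖ * √N + 1 := by
  set G : ℕ → A := fun i => cfcₙ (ramp δ i) b with hG
  have hGn : ∀ i, ‖G i‖ ≤ 1 := fun i => norm_cfcₙ_le fun t _ => by
    rw [Real.norm_of_nonneg (ramp_nonneg _ _ _)]; exact ramp_le_one _ _ _
  have hGs : ∀ i, star (G i) = G i := fun i => (cfcₙ_predicate (ramp δ i) b : IsSelfAdjoint _)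
  have hGG : ∀ i, G (i + 1) * G i = G (i + 1) := fun i => by
    rw [hG]
    simp only
    rw [← cfcₙ_mul _ _ b (continuous_ramp _ _).continuousOn (ramp_zero _ _)
      (continuous_ramp _ _).continuousOn (ramp_zero _ _)]
    simp only [ramp_succ_mul]
  have hDD : ‖∑ i ∈ Finset.range N, (G i - G (i + 1)) * (G i - G (i + 1))‖ ≤ 1 := by
    have e : ∑ i ∈ Finset.range N, (G i - G (i + 1)) * (G i - G (i + 1))
        = cfcₙ (fun t => ∑ i ∈ Finset.range N,
          (ramp δ i t - ramp δ (i + 1) t) * (ramp δ i t - ramp δ (i + 1) t)) b := by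
      have hc : ∀ i, Continuous fun t => ramp δ i t - ramp δ (i + 1) t := fun i =>
        (continuous_ramp δ i).sub (continuous_ramp δ (i + 1))
      have h0 : ∀ i, ramp δ i 0 - ramp δ (i + 1) 0 = 0 := fun i => by simp [ramp_zero]
      have hs := cfcₙ_sum (fun i t => (ramp δ i t - ramp δ (i + 1) t)
        * (ramp δ i t - ramp δ (i + 1) t)) b (Finset.range N)
        (fun i _ => ((hc i).mul (hc i)).continuousOn) (fun i _ => by simp [h0])
      have hfun : (fun t => ∑ i ∈ Finset.range N,
          (ramp δ i t - ramp δ (i + 1) t) * (ramp δ i t - ramp δ (i + 1) t))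
          = ∑ i ∈ Finset.range N, fun t => (ramp δ i t - ramp δ (i + 1) t)
            * (ramp δ i t - ramp δ (i + 1) t) := by ext t; simp
      rw [hfun, hs]
      refine Finset.sum_congr rfl fun i _ => ?_
      rw [cfcₙ_mul _ _ b (hc i).continuousOn (h0 i) (hc i).continuousOn (h0 i),
        cfcₙ_sub _ _ b (continuous_ramp δ i).continuousOn (ramp_zero _ _)
          (continuous_ramp δ (i + 1)).continuousOn (ramp_zero _ _)]
    rw [e]
    refine norm_cfcₙ_le fun t _ => ?_
    rw [Real.norm_of_nonneg (Finset.sum_nonneg fun i _ => mul_self_nonneg _)]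
    exact sum_ramp_sub_sq_le δ t N
  have hlim : Tendsto (fun l => ∑ i ∈ Finset.range N, ‖ψ l (a * G (i + 1)) * ψ l (c - G i * c)‖) F
      (𝓝 0) := by
    have : Tendsto (fun l => ∑ i ∈ Finset.range N, ‖ψ l (a * G (i + 1)) * ψ l (c - G i * c)‖) F
        (𝓝 (∑ i ∈ Finset.range N, (0 : ℝ))) := by
      refine tendsto_finsetSum _ fun i _ => h.tendsto_mul_of_mul_eq_zero ?_
      rw [mul_assoc, mul_sub, ← mul_assoc (G (i + 1)), hGG, sub_self, mul_zero]
    simpa using this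
  filter_upwards [hlim.eventually (ge_mem_nhds zero_lt_one)] with l hl
  have hS := h.schwarz l
  have hsplit : ∑ i ∈ Finset.range N, ψ l (a * G i) * ψ l (c - G i * c)
      = ∑ i ∈ Finset.range N, ψ l (a * (G i - G (i + 1))) * ψ l (c - G i * c)
        + ∑ i ∈ Finset.range N, ψ l (a * G (i + 1)) * ψ l (c - G i * c) := by
    rw [← Finset.sum_add_distrib]
    refine Finset.sum_congr rfl fun i _ => ?_
    rw [← add_mul, ← map_add, ← mul_add, sub_add_cancel]
  have hCS : ‖∑ i ∈ Finset.range N, ψ l (a * (G i - G (i + 1))) * ψ l (c - G i * c)‖ ^ 2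
      ≤ (2 * ‖a‖ * ‖c‖ * √N) ^ 2 := by
    rw [← Fin.sum_univ_eq_sum_range
      (fun i => ψ l (a * (G i - G (i + 1))) * ψ l (c - G i * c)) N]
    refine (norm_sum_mul_sq_le (A := C l) _ _).trans ?_
    have b1 : ‖∑ i : Fin N, ψ l (a * (G i - G (i + 1))) * star (ψ l (a * (G i - G (i + 1))))‖
        ≤ ‖a‖ ^ 2 := by
      have hle : ∑ i : Fin N, ψ l (a * (G i - G (i + 1))) * star (ψ l (a * (G i - G (i + 1))))
          ≤ ψ l (a * (∑ i ∈ Finset.range N, (G i - G (i + 1)) * (G i - G (i + 1))) * star a) := by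
        rw [← Fin.sum_univ_eq_sum_range (fun i => (G i - G (i + 1)) * (G i - G (i + 1))) N,
          Finset.mul_sum, Finset.sum_mul, map_sum]
        refine Finset.sum_le_sum fun i _ => (hS.mul_star_le _).trans (le_of_eq ?_)
        congr 1
        rw [star_mul, star_sub, hGs, hGs]
        noncomm_ring
      refine (CStarAlgebra.norm_le_norm_of_nonneg_of_le
        (Finset.sum_nonneg fun i _ => mul_star_self_nonneg _) hle).trans ?_
      refine (hS.norm_le _).trans ?_
      calc _ ≤ ‖a‖ * ‖∑ i ∈ Finset.range N, (G i - G (i + 1)) * (G i - G (i + 1))‖ * ‖star a‖ :=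
            (norm_mul_le _ _).trans (by gcongr; exact norm_mul_le _ _)
        _ ≤ ‖a‖ * 1 * ‖star a‖ := by gcongr
        _ = ‖a‖ ^ 2 := by rw [norm_star]; ring
    have b2 : ‖∑ i : Fin N, star (ψ l (c - G i * c)) * ψ l (c - G i * c)‖
        ≤ N * (2 * ‖c‖) ^ 2 := by
      refine (norm_sum_le _ _).trans ?_
      have : ∀ i : Fin N, ‖star (ψ l (c - G i * c)) * ψ l (c - G i * c)‖ ≤ (2 * ‖c‖) ^ 2 := by
        intro i
        rw [CStarRing.norm_star_mul_self, ← sq]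
        gcongr
        refine (hS.norm_le _).trans ((norm_sub_le _ _).trans ?_)
        have := (norm_mul_le (G i) c).trans (mul_le_of_le_one_left (norm_nonneg c) (hGn i))
        linarith
      refine (Finset.sum_le_sum fun i _ => this i).trans ?_
      simp
    calc _ ≤ ‖a‖ ^ 2 * (N * (2 * ‖c‖) ^ 2) := by gcongr
      _ = _ := by rw [mul_pow _ (√N), Real.sq_sqrt (Nat.cast_nonneg N)]; ring
  have hCS' := le_of_sq_le_sq hCS (by positivity)
  rw [hsplit]
  refine (norm_add_le _ _).trans (add_le_add hCS' ((norm_sum_le _ _).trans hl))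

/-- Write `b` as `δ` times a sum of `N` ramps, with `δ` of order `1 / N`, and move the ramps across
one by one: the total error is of order `√N / N`. -/
lemma tendsto_map_mul_of_nonneg (h : IsAsymptoticallyOrderZero F ψ) {b : A} (hb : 0 ≤ b)
    (a c : A) :
    Tendsto (fun l => ‖ψ l (a * b) * ψ l c - ψ l a * ψ l (b * c)‖) F (𝓝 0) := by
  rw [Metric.tendsto_nhds]
  intro ε hε
  set R := ‖b‖ + 1 with hR
  have hRpos : 0 < R := by positivity
  set K := ‖a‖ * ‖c‖ with hK
  have hK0 : 0 ≤ K := by positivity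
  obtain ⟨N, hN⟩ := exists_nat_gt (max 1 ((R * (4 * K + 2) / ε) ^ 2))
  have hN1 : (1 : ℝ) < N := (le_max_left _ _).trans_lt hN
  have hN2 : R * (4 * K + 2) / ε < √N :=
    Real.lt_sqrt_of_sq_lt ((le_max_right _ _).trans_lt hN)
  have hNpos : (0 : ℝ) < N := by linarith
  set δ := R / N with hδ
  have hδpos : 0 < δ := by positivity
  set G : ℕ → A := fun i => cfcₙ (ramp δ i) b with hG
  have hGs : ∀ i, star (G i) = G i := fun i => (cfcₙ_predicate (ramp δ i) b : IsSelfAdjoint _)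
  have hbsum : b = δ • ∑ i ∈ Finset.range N, G i := by
    have hs := cfcₙ_sum (fun i => ramp δ i) b (Finset.range N)
        (fun i _ => (continuous_ramp δ i).continuousOn) (fun i _ => ramp_zero δ i)
    rw [← hs, ← cfcₙ_const_mul δ _ b (Continuous.continuousOn (by
        simp only [Finset.sum_fn]; exact continuous_finsetSum _ fun i _ => continuous_ramp δ i))
        (by simp [ramp_zero])]
    conv_lhs => rw [← cfcₙ_id' ℝ b]
    refine cfcₙ_congr fun t ht => ?_
    have ht0 := quasispectrum_nonneg_of_nonneg b hb t ht
    have htb : t ≤ ‖b‖ := (le_abs_self t).trans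
      (NonUnitalIsometricContinuousFunctionalCalculus.norm_quasispectrum_le b ht)
    simp only [Finset.sum_apply]
    rw [sum_ramp δ (by positivity) N, min_eq_left]
    · field_simp
    · rw [div_le_iff₀ hδpos, hδ]
      field_simp
      linarith
  filter_upwards [h.eventually_norm_sum_ramp_le a b c δ N,
    h.eventually_norm_sum_ramp_le (star c) b (star a) δ N] with l h1 h2
  have hS := h.schwarz l
  have hsm : ∀ (r : ℝ) (x : A), ψ l (r • x) = r • ψ l x := fun r x => by
    rw [← Complex.coe_smul, map_smul, Complex.coe_smul]
  have h2' : ‖∑ i ∈ Finset.range N, ψ l (a - a * G i) * ψ l (G i * c)‖ ≤ 2 * K * √N + 1 := by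
    rw [norm_star, norm_star] at h2
    rw [← norm_star, star_sum]
    refine le_trans (le_of_eq ?_) (h2.trans (le_of_eq (by rw [hK]; ring)))
    congr 1
    refine Finset.sum_congr rfl fun i _ => ?_
    rw [star_mul, ← hS.map_star, ← hS.map_star, star_mul, star_sub, star_mul, hGs]
  have hD : ψ l (a * b) * ψ l c - ψ l a * ψ l (b * c)
      = δ • (∑ i ∈ Finset.range N, ψ l (a * G i) * ψ l (c - G i * c)
        - ∑ i ∈ Finset.range N, ψ l (a - a * G i) * ψ l (G i * c)) := by
    conv_lhs => rw [hbsum]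
    rw [mul_smul_comm, smul_mul_assoc, hsm, hsm, smul_mul_assoc, mul_smul_comm, ← smul_sub,
      Finset.mul_sum, Finset.sum_mul, map_sum, map_sum, Finset.sum_mul, Finset.mul_sum,
      ← Finset.sum_sub_distrib, ← Finset.sum_sub_distrib]
    congr 1
    refine Finset.sum_congr rfl fun i _ => ?_
    rw [map_sub, map_sub, mul_sub, sub_mul]
    abel
  rw [Real.dist_eq, sub_zero, abs_norm, hD, norm_smul, Real.norm_of_nonneg hδpos.le]
  have h3 : δ * ‖∑ i ∈ Finset.range N, ψ l (a * G i) * ψ l (c - G i * c)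
        - ∑ i ∈ Finset.range N, ψ l (a - a * G i) * ψ l (G i * c)‖
      ≤ δ * ((2 * ‖a‖ * ‖c‖ * √N + 1) + (2 * K * √N + 1)) := by
    gcongr
    exact (norm_sub_le _ _).trans (add_le_add h1 h2')
  refine h3.trans_lt ?_
  have hsN : √N * √N = (N : ℝ) := Real.mul_self_sqrt hNpos.le
  have hsN1 : 1 ≤ √N := Real.one_le_sqrt.2 hN1.le
  rw [div_lt_iff₀ hε] at hN2
  have h4 : (2 * ‖a‖ * ‖c‖ * √N + 1) + (2 * K * √N + 1) ≤ (4 * K + 2) * √N := by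
    have : 2 * ‖a‖ * ‖c‖ = 2 * K := by rw [hK]; ring
    rw [this]
    nlinarith
  calc δ * ((2 * ‖a‖ * ‖c‖ * √N + 1) + (2 * K * √N + 1)) ≤ δ * ((4 * K + 2) * √N) := by gcongr
    _ = R * (4 * K + 2) * √N / N := by rw [hδ]; ring
    _ < ε := by
      rw [div_lt_iff₀ hNpos]
      calc R * (4 * K + 2) * √N < √N * ε * √N := by gcongr
        _ = ε * (√N * √N) := by ring
        _ = ε * N := by rw [hsN]

/-- Asymptotically order zero maps asymptotically satisfy the identity
`ψ (a * b) * ψ c = ψ a * ψ (b * c)`. -/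
lemma tendsto_map_mul (h : IsAsymptoticallyOrderZero F ψ) (a b c : A) :
    Tendsto (fun l => ‖ψ l (a * b) * ψ l c - ψ l a * ψ l (b * c)‖) F (𝓝 0) := by
  have hb : b ∈ Submodule.span ℂ {a : A | 0 ≤ a} := by
    rw [CStarAlgebra.span_nonneg]; trivial
  induction hb using Submodule.span_induction with
  | mem b hb => exact h.tendsto_map_mul_of_nonneg hb a c
  | zero => simpa using tendsto_const_nhds
  | add x y _ _ hx hy =>
    refine squeeze_zero (fun _ => norm_nonneg _) (fun l => ?_) (by simpa using hx.add hy)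
    refine le_trans (le_of_eq ?_) (norm_add_le _ _)
    congr 1
    simp only [mul_add, add_mul, map_add]
    abel
  | smul z x _ hx =>
    refine squeeze_zero (fun _ => norm_nonneg _) (fun l => le_of_eq ?_)
      (by simpa using hx.const_mul ‖z‖)
    rw [← norm_smul]
    congr 1
    simp only [mul_smul_comm, smul_mul_assoc, map_smul, smul_sub]

end IsAsymptoticallyOrderZero

end Asymptotic

/-! ### Limits of traces -/

section Trace

variable {A : Type*} [NonUnitalCStarAlgebra A] [PartialOrder A] [StarOrderedRing A]

/-- The elements `y` with a local unit `e` are dense: `y` is close to `f d * y * f d` with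
`d = star y * y + y * star y` and a function `f` vanishing near zero. -/
lemma exists_localUnit (y : A) {ε : ℝ} (hε : 0 < ε) :
    ∃ y' e : A, ‖y - y'‖ ≤ ε ∧ 0 ≤ e ∧ ‖e‖ ≤ 1 ∧ e * y' = y' ∧ y' * e = y' := by
  set d := star y * y + y * star y with hd
  have hd0 : 0 ≤ d := add_nonneg (star_mul_self_nonneg y) (mul_star_self_nonneg y)
  obtain ⟨δ, hδ, hδε⟩ : ∃ δ : ℝ, 0 < δ ∧ 2 * δ ≤ (ε / 2) ^ 2 :=
    ⟨(ε / 2) ^ 2 / 2, by positivity, by linarith⟩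
  set F := cfcₙ (ramp δ 1) d with hF
  set e := cfcₙ (ramp δ 0) d with he
  have hFs : star F = F := (cfcₙ_predicate (ramp δ 1) d : IsSelfAdjoint _)
  have hes : star e = e := (cfcₙ_predicate (ramp δ 0) d : IsSelfAdjoint _)
  have hFe : F * e = F := by
    rw [hF, he, ← cfcₙ_mul _ _ d (continuous_ramp _ _).continuousOn (ramp_zero _ _)
      (continuous_ramp _ _).continuousOn (ramp_zero _ _)]
    congr 1; ext t; exact ramp_succ_mul δ 0 t
  have heF : e * F = F := by simpa [hFs, hes] using congrArg star hFe
  have hFn : ‖F‖ ≤ 1 := norm_cfcₙ_le fun t _ => by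
    rw [Real.norm_of_nonneg (ramp_nonneg _ _ _)]; exact ramp_le_one _ _ _
  have hen : ‖e‖ ≤ 1 := norm_cfcₙ_le fun t _ => by
    rw [Real.norm_of_nonneg (ramp_nonneg _ _ _)]; exact ramp_le_one _ _ _
  have happrox : ∀ w : A, star w * w ≤ d → ‖w - w * F‖ ≤ ε / 2 := by
    intro w hw
    refine le_of_sq_le_sq ?_ (by positivity)
    refine (norm_sub_mul_cfcₙ_sq_le (M := 1) (η := 2 * δ) zero_le_one hd0 (by simpa using hw)
      (continuous_ramp δ 1) (ramp_zero δ 1) fun t ht => ?_).trans (by linarith)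
    have ht0 := quasispectrum_nonneg_of_nonneg d hd0 t ht
    have r0 := ramp_nonneg δ 1 t
    have r1 := ramp_le_one δ 1 t
    by_cases h2 : t ≤ 2 * δ
    · calc t * (1 - ramp δ 1 t) ^ 2 ≤ t * 1 := by
            gcongr; exact pow_le_one₀ (by linarith) (by linarith)
        _ ≤ 2 * δ := by linarith
    · push Not at h2
      have : ramp δ 1 t = 1 := by
        have : 2 < t / δ := (lt_div_iff₀ hδ).2 h2
        unfold ramp
        rw [min_eq_left (by push_cast; linarith)]; simp
      rw [this]; simp; positivity
  have h1 : ‖y - y * F‖ ≤ ε / 2 := happrox y (le_add_of_nonneg_right (mul_star_self_nonneg y))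
  have h2 : ‖y - F * y‖ ≤ ε / 2 := by
    have := happrox (star y) (by
      rw [star_star]; exact le_add_of_nonneg_left (star_mul_self_nonneg y))
    rw [← norm_star] at this
    simpa [hFs] using this
  refine ⟨F * y * F, e, ?_, cfcₙ_nonneg fun t _ => ramp_nonneg _ _ _, hen, ?_, ?_⟩
  · calc ‖y - F * y * F‖ = ‖(y - F * y) + F * (y - y * F)‖ := by congr 1; noncomm_ring
      _ ≤ ‖y - F * y‖ + 1 * ‖y - y * F‖ := (norm_add_le _ _).trans (by
          gcongr; exact (norm_mul_le _ _).trans (by gcongr))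
      _ ≤ ε := by linarith
  · rw [← mul_assoc, ← mul_assoc, heF]
  · rw [mul_assoc, hFe]

/-- The polynomials `1 - (1 - t) ^ n`, which increase to `1` on `(0, 1]`. The recursion
`unitPoly_succ` allows inductive proofs about `unitPoly n (ψ e)`. -/
noncomputable def unitPoly (n : ℕ) (t : ℝ) : ℝ := 1 - (1 - t) ^ n

lemma continuous_unitPoly (n : ℕ) : Continuous (unitPoly n) := by
  unfold unitPoly; fun_prop

lemma unitPoly_zero (n : ℕ) : unitPoly n 0 = 0 := by simp [unitPoly]

lemma unitPoly_succ (n : ℕ) (t : ℝ) :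
    unitPoly (n + 1) t = unitPoly n t + t - t * unitPoly n t := by
  unfold unitPoly; ring

lemma mul_one_sub_unitPoly_sq_le {n : ℕ} (hn : 0 < n) {t : ℝ} (h0 : 0 ≤ t) (h1 : t ≤ 1) :
    t * (1 - unitPoly n t) ^ 2 ≤ 1 / n := by
  have hb : 1 + n * t ≤ (1 + t) ^ n := one_add_mul_le_pow (by linarith) n
  have hs : (1 - t) ^ n * (1 + t) ^ n ≤ 1 := by
    rw [← mul_pow]
    exact pow_le_one₀ (by nlinarith) (by nlinarith)
  have hp : 0 ≤ (1 - t) ^ n := pow_nonneg (by linarith) n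
  have hp1 : (1 - t) ^ n ≤ 1 := pow_le_one₀ (by linarith) (by linarith)
  have hnp : (0 : ℝ) < n := by exact_mod_cast hn
  have e : t * (1 - unitPoly n t) ^ 2 = t * (1 - t) ^ n * (1 - t) ^ n := by
    unfold unitPoly; ring
  rw [e, le_div_iff₀ hnp]
  have h3 : (1 - t) ^ n * (1 + n * t) ≤ 1 := (mul_le_mul_of_nonneg_left hb hp).trans hs
  have h4 : t * (1 - t) ^ n * (1 - t) ^ n ≤ t * (1 - t) ^ n :=
    mul_le_of_le_one_right (mul_nonneg h0 hp) hp1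
  nlinarith

lemma cfcₙ_unitPoly_succ {B : Type*} [NonUnitalCStarAlgebra B] {H : B} (hH : IsSelfAdjoint H)
    (n : ℕ) : cfcₙ (unitPoly (n + 1)) H
      = cfcₙ (unitPoly n) H + H - H * cfcₙ (unitPoly n) H := by
  have hid : cfcₙ (fun t : ℝ => t) H = H := cfcₙ_id' ℝ H
  have hc := (continuous_unitPoly n)
  have h0 := unitPoly_zero n
  have hf : unitPoly (n + 1) = fun t => unitPoly n t + t - t * unitPoly n t := by
    ext t; exact unitPoly_succ n t
  rw [hf, cfcₙ_sub (fun t => unitPoly n t + t) (fun t => t * unitPoly n t) H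
      (hc.add continuous_id).continuousOn (by simp [h0]) (continuous_id.mul hc).continuousOn
      (by simp),
    cfcₙ_add (unitPoly n) (fun t => t) H hc.continuousOn h0,
    cfcₙ_mul (fun t => t) (unitPoly n) H continuousOn_id rfl hc.continuousOn h0, hid]

lemma cfcₙ_unitPoly_zero {B : Type*} [NonUnitalCStarAlgebra B] (H : B) :
    cfcₙ (unitPoly 0) H = 0 := by
  have : unitPoly 0 = fun _ => 0 := by ext t; simp [unitPoly]
  rw [this, cfcₙ_const_zero]

lemma quasispectrum_mem_Icc {B : Type*} [NonUnitalCStarAlgebra B] [PartialOrder B]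
    [StarOrderedRing B] {H : B} (h0 : 0 ≤ H) (h1 : ‖H‖ ≤ 1) {t : ℝ} (ht : t ∈ quasispectrum ℝ H) :
    0 ≤ t ∧ t ≤ 1 :=
  ⟨quasispectrum_nonneg_of_nonneg H h0 t ht, (le_abs_self t).trans
    ((NonUnitalIsometricContinuousFunctionalCalculus.norm_quasispectrum_le H ht
      (IsSelfAdjoint.of_nonneg h0)).trans h1)⟩

lemma norm_cfcₙ_unitPoly_le {B : Type*} [NonUnitalCStarAlgebra B] [PartialOrder B]
    [StarOrderedRing B] {H : B} (h0 : 0 ≤ H) (h1 : ‖H‖ ≤ 1) (n : ℕ) :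
    ‖cfcₙ (unitPoly n) H‖ ≤ 1 := norm_cfcₙ_le fun t ht => by
  obtain ⟨ht0, ht1⟩ := quasispectrum_mem_Icc h0 h1 ht
  have hp : 0 ≤ (1 - t) ^ n := pow_nonneg (by linarith) n
  have hp1 : (1 - t) ^ n ≤ 1 := pow_le_one₀ (by linarith) (by linarith)
  rw [Real.norm_of_nonneg (by unfold unitPoly; linarith)]
  unfold unitPoly; linarith

namespace IsAsymptoticallyOrderZero

variable {Λ : Type*} {F : Filter Λ} {C : Λ → Type*}
    [∀ l, NonUnitalCStarAlgebra (C l)] [∀ l, PartialOrder (C l)] [∀ l, StarOrderedRing (C l)]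
    {ψ : ∀ l, A →ₗ[ℂ] C l}

lemma tendsto_commute (h : IsAsymptoticallyOrderZero F ψ) {e y : A} (h1 : e * y = y)
    (h2 : y * e = y) : Tendsto (fun l => ‖ψ l e * ψ l y - ψ l y * ψ l e‖) F (𝓝 0) := by
  have := h.tendsto_map_mul e y e
  rw [h1, h2] at this
  simpa only [norm_sub_rev] using this

section

variable {e y : A} {n : ℕ}

lemma map_nonneg_norm_le (h : IsAsymptoticallyOrderZero F ψ) (he0 : 0 ≤ e) (he1 : ‖e‖ ≤ 1)
    (l : Λ) : 0 ≤ ψ l e ∧ ‖ψ l e‖ ≤ 1 :=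
  ⟨(h.schwarz l).nonneg e he0, ((h.schwarz l).norm_le e).trans he1⟩

lemma tendsto_commute_unitPoly (h : IsAsymptoticallyOrderZero F ψ) (he0 : 0 ≤ e) (he1 : ‖e‖ ≤ 1)
    (h1 : e * y = y) (h2 : y * e = y) (n : ℕ) :
    Tendsto (fun l => ‖cfcₙ (unitPoly n) (ψ l e) * ψ l y - ψ l y * cfcₙ (unitPoly n) (ψ l e)‖) F
      (𝓝 0) := by
  induction n with
  | zero => simpa [cfcₙ_unitPoly_zero] using tendsto_const_nhds
  | succ n ih =>
    have hH := h.tendsto_commute h1 h2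
    refine squeeze_zero (fun _ => norm_nonneg _) (fun l => ?_)
      (by simpa using (ih.add hH).add (ih.add hH))
    obtain ⟨hn0, hn1⟩ := h.map_nonneg_norm_le he0 he1 l
    rw [cfcₙ_unitPoly_succ (IsSelfAdjoint.of_nonneg hn0)]
    set H := ψ l e
    set Y := ψ l y
    set K := cfcₙ (unitPoly n) H
    have hK : ‖K‖ ≤ 1 := norm_cfcₙ_unitPoly_le hn0 hn1 n
    calc ‖(K + H - H * K) * Y - Y * (K + H - H * K)‖
        = ‖((K * Y - Y * K) + (H * Y - Y * H)) - (H * (K * Y - Y * K) + (H * Y - Y * H) * K)‖ := by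
          congr 1; noncomm_ring
      _ ≤ (‖K * Y - Y * K‖ + ‖H * Y - Y * H‖) + (‖K * Y - Y * K‖ + ‖H * Y - Y * H‖) := by
          refine (norm_sub_le _ _).trans (add_le_add (norm_add_le _ _) ?_)
          refine (norm_add_le _ _).trans (add_le_add ?_ ?_)
          · exact (norm_mul_le _ _).trans (mul_le_of_le_one_left (norm_nonneg _) hn1)
          · exact (norm_mul_le _ _).trans (mul_le_of_le_one_right (norm_nonneg _) hK)

variable {τ : ∀ l, C l →ₗ[ℂ] ℂ}

/-- With `K = unitPoly n (ψ e)`, the functional `τ (ψ (·) * K)` is asymptotically tracial. The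
induction step is `K ↦ K + H - H * K` with `H = ψ e`, and `ψ (y* y) * H` is nearly `ψ (y*) * ψ y`. -/
lemma tendsto_trace_unitPoly (h : IsAsymptoticallyOrderZero F ψ)
    (hτ : ∀ l x y, τ l (x * y) = τ l (y * x)) (hτn : ∀ l x, ‖τ l x‖ ≤ ‖x‖)
    (he0 : 0 ≤ e) (he1 : ‖e‖ ≤ 1) (h1 : e * y = y) (h2 : y * e = y) (n : ℕ) :
    Tendsto (fun l => ‖τ l (ψ l (star y * y) * cfcₙ (unitPoly n) (ψ l e))
      - τ l (ψ l (y * star y) * cfcₙ (unitPoly n) (ψ l e))‖) F (𝓝 0) := by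
  have hes : star e = e := (IsSelfAdjoint.of_nonneg he0).star_eq
  have h1' : star y * e = star y := by simpa [hes] using congrArg star h1
  have h2' : e * star y = star y := by simpa [hes] using congrArg star h2
  induction n with
  | zero => simpa [cfcₙ_unitPoly_zero] using tendsto_const_nhds
  | succ n ih =>
    have a1 := h.tendsto_map_mul (star y) y e
    have a2 := h.tendsto_map_mul y (star y) e
    rw [h2] at a1
    rw [h1'] at a2
    have a3 := h.tendsto_commute_unitPoly he0 he1 h1 h2 n
    refine squeeze_zero (fun _ => norm_nonneg _) (fun l => ?_)
      (by simpa using (((ih.add a1).add a2).add (a1.add a2)).add (a3.const_mul ‖y‖))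
    obtain ⟨hn0, hn1⟩ := h.map_nonneg_norm_le he0 he1 l
    rw [cfcₙ_unitPoly_succ (IsSelfAdjoint.of_nonneg hn0)]
    have hYn : ‖ψ l (star y)‖ ≤ ‖y‖ := ((h.schwarz l).norm_le _).trans (norm_star y).le
    set H := ψ l e
    set Y := ψ l y
    set Z := ψ l (star y)
    set X₁ := ψ l (star y * y)
    set X₂ := ψ l (y * star y)
    set K := cfcₙ (unitPoly n) H
    have hK : ‖K‖ ≤ 1 := norm_cfcₙ_unitPoly_le hn0 hn1 n
    have e1 : τ l (X₁ * (K + H - H * K)) - τ l (X₂ * (K + H - H * K))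
        = (τ l (X₁ * K) - τ l (X₂ * K)) + τ l (X₁ * H - Z * Y) - τ l (X₂ * H - Y * Z)
          - τ l ((X₁ * H - Z * Y) * K) + τ l ((X₂ * H - Y * Z) * K)
          + τ l (Z * (K * Y - Y * K)) := by
      have t1 : τ l (Z * Y) = τ l (Y * Z) := hτ l _ _
      have t2 : τ l (Z * (K * Y)) = τ l (Y * Z * K) := by
        rw [← mul_assoc, hτ, ← mul_assoc]
      simp only [mul_add, mul_sub, sub_mul, map_add, map_sub, ← mul_assoc] at t2 ⊢
      rw [t1, t2]
      ring
    have b0 : ∀ x : C l, ‖τ l (x * K)‖ ≤ ‖x‖ := fun x =>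
      (hτn l _).trans ((norm_mul_le _ _).trans (mul_le_of_le_one_right (norm_nonneg _) hK))
    have b1 : ‖τ l (Z * (K * Y - Y * K))‖ ≤ ‖y‖ * ‖K * Y - Y * K‖ :=
      (hτn l _).trans ((norm_mul_le _ _).trans (by gcongr))
    rw [e1]
    have n1 := norm_add_le ((τ l (X₁ * K) - τ l (X₂ * K)) + τ l (X₁ * H - Z * Y)
      - τ l (X₂ * H - Y * Z) - τ l ((X₁ * H - Z * Y) * K) + τ l ((X₂ * H - Y * Z) * K))
      (τ l (Z * (K * Y - Y * K)))
    have n2 := norm_add_le ((τ l (X₁ * K) - τ l (X₂ * K)) + τ l (X₁ * H - Z * Y)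
      - τ l (X₂ * H - Y * Z) - τ l ((X₁ * H - Z * Y) * K)) (τ l ((X₂ * H - Y * Z) * K))
    have n3 := norm_sub_le ((τ l (X₁ * K) - τ l (X₂ * K)) + τ l (X₁ * H - Z * Y)
      - τ l (X₂ * H - Y * Z)) (τ l ((X₁ * H - Z * Y) * K))
    have n4 := norm_sub_le ((τ l (X₁ * K) - τ l (X₂ * K)) + τ l (X₁ * H - Z * Y))
      (τ l (X₂ * H - Y * Z))
    have n5 := norm_add_le (τ l (X₁ * K) - τ l (X₂ * K)) (τ l (X₁ * H - Z * Y))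
    have m1 := hτn l (X₁ * H - Z * Y)
    have m2 := hτn l (X₂ * H - Y * Z)
    have m3 := b0 (X₁ * H - Z * Y)
    have m4 := b0 (X₂ * H - Y * Z)
    linarith

/-- For elements with a local unit, asymptotically order zero maps pull traces back to functionals
that are asymptotically tracial: `unitPoly n (ψ e)` acts as a unit on `ψ (y* y)` up to an error that
is small for large `n`, uniformly in `l`. -/
lemma tendsto_trace_of_localUnit (h : IsAsymptoticallyOrderZero F ψ)
    (hτ : ∀ l x y, τ l (x * y) = τ l (y * x)) (hτn : ∀ l x, ‖τ l x‖ ≤ ‖x‖)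
    (he0 : 0 ≤ e) (he1 : ‖e‖ ≤ 1) (h1 : e * y = y) (h2 : y * e = y) :
    Tendsto (fun l => τ l (ψ l (star y * y)) - τ l (ψ l (y * star y))) F (𝓝 0) := by
  rw [Metric.tendsto_nhds]
  intro ε hε
  have hes : star e = e := (IsSelfAdjoint.of_nonneg he0).star_eq
  have h1' : star y * e = star y := by simpa [hes] using congrArg star h1
  have h2' : e * star y = star y := by simpa [hes] using congrArg star h2
  -- both `star y * y` and `y * star y` are dominated by `e`
  have hdom : ∀ x : A, star x = x → e * x = x → x * e = x → star x * x ≤ ‖x‖ ^ 2 • e := by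
    intro x hx hex hxe
    have a1 := CStarAlgebra.star_left_conjugate_le_norm_smul (a := e) (b := star x * x)
      (hb := IsSelfAdjoint.star_mul_self x)
    have a2 : star e * (star x * x) * e = star x * x := by
      rw [hes, hx, mul_assoc, mul_assoc, hxe, ← mul_assoc, hex]
    rw [a2, hes, CStarRing.norm_star_mul_self, ← sq] at a1
    refine a1.trans (smul_le_smul_of_nonneg_left ?_ (sq_nonneg _))
    exact (mul_self_le_norm_smul he0).trans (smul_le_of_le_one_left he0 he1)
  have hM : ∀ x : A, star x = x → e * x = x → x * e = x → ‖x‖ = ‖y‖ ^ 2 →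
      ∀ n : ℕ, 0 < n → ∀ l, ‖ψ l x - ψ l x * cfcₙ (unitPoly n) (ψ l e)‖ ^ 2
        ≤ (‖y‖ ^ 2) ^ 2 * (1 / n) := by
    intro x hx hex hxe hxy n hn l
    obtain ⟨hn0, hn1⟩ := h.map_nonneg_norm_le he0 he1 l
    refine norm_sub_mul_cfcₙ_sq_le (by positivity) hn0 ?_ (continuous_unitPoly n)
      (unitPoly_zero n) fun t ht => ?_
    · refine ((h.schwarz l).star_mul_le x).trans ?_
      have := (h.schwarz l).mono (hdom x hx hex hxe)
      rwa [hxy, ← Complex.coe_smul, map_smul, Complex.coe_smul] at this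
    · obtain ⟨t0, t1⟩ := quasispectrum_mem_Icc hn0 hn1 ht
      exact mul_one_sub_unitPoly_sq_le hn t0 t1
  obtain ⟨n, hn⟩ := exists_nat_gt ((‖y‖ ^ 2) ^ 2 / (ε / 4) ^ 2)
  have hn0 : (0 : ℝ) < n := lt_of_le_of_lt (by positivity) hn
  have hbound : (‖y‖ ^ 2) ^ 2 * (1 / n) ≤ (ε / 4) ^ 2 := by
    rw [div_lt_iff₀ (by positivity)] at hn
    rw [mul_one_div, div_le_iff₀ hn0]
    linarith
  have hnpos : 0 < n := by exact_mod_cast hn0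
  have hlim := h.tendsto_trace_unitPoly hτ hτn he0 he1 h1 h2 n
  filter_upwards [hlim.eventually (gt_mem_nhds (show (0 : ℝ) < ε / 4 by positivity))] with l hl
  set K := cfcₙ (unitPoly n) (ψ l e)
  have c1 : ‖ψ l (star y * y) - ψ l (star y * y) * K‖ ≤ ε / 4 :=
    le_of_sq_le_sq ((hM (star y * y) (by simp) (by rw [← mul_assoc, h2'])
      (by rw [mul_assoc, h2]) (by rw [CStarRing.norm_star_mul_self, sq]) n hnpos l).trans hbound)
      (by positivity)
  have c2 : ‖ψ l (y * star y) - ψ l (y * star y) * K‖ ≤ ε / 4 :=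
    le_of_sq_le_sq ((hM (y * star y) (by simp) (by rw [← mul_assoc, h1])
      (by rw [mul_assoc, h1']) (by rw [CStarRing.norm_self_mul_star, sq]) n hnpos l).trans hbound)
      (by positivity)
  rw [dist_zero_right]
  calc ‖τ l (ψ l (star y * y)) - τ l (ψ l (y * star y))‖
      = ‖τ l (ψ l (star y * y) - ψ l (star y * y) * K)
        + (τ l (ψ l (star y * y) * K) - τ l (ψ l (y * star y) * K))
        - τ l (ψ l (y * star y) - ψ l (y * star y) * K)‖ := by
          congr 1; rw [map_sub, map_sub]; ring
    _ ≤ ε / 4 + ε / 4 + ε / 4 := by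
        refine (norm_sub_le _ _).trans (add_le_add ((norm_add_le _ _).trans
          (add_le_add ((hτn l _).trans c1) hl.le)) ((hτn l _).trans c2))
    _ < ε := by linarith

end

/-- Traces pulled back along asymptotically order zero maps converge, along an ultrafilter, to
bounded traces. -/
lemma exists_isBoundedTrace {U : Ultrafilter Λ} (h : IsAsymptoticallyOrderZero (U : Filter Λ) ψ)
    {τ : ∀ l, C l →ₗ[ℂ] ℂ} (hτ : ∀ l x y, τ l (x * y) = τ l (y * x))
    (hτn : ∀ l x, ‖τ l x‖ ≤ ‖x‖) (hτ0 : ∀ l x, 0 ≤ x → 0 ≤ τ l x) :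
    ∃ σ : A →L[ℂ] ℂ, IsBoundedTrace σ ∧
      ∀ x, Tendsto (fun l => τ l (ψ l x)) (U : Filter Λ) (𝓝 (σ x)) := by
  have hbd : ∀ l x, ‖τ l (ψ l x)‖ ≤ ‖x‖ := fun l x => (hτn l _).trans ((h.schwarz l).norm_le x)
  have hex : ∀ x, ∃ z : ℂ, ‖z‖ ≤ ‖x‖ ∧ Tendsto (fun l => τ l (ψ l x)) (U : Filter Λ) (𝓝 z) := by
    intro x
    obtain ⟨z, hz, hUz⟩ := (isCompact_closedBall (0 : ℂ) ‖x‖).ultrafilter_le_nhds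
      (U.map fun l => τ l (ψ l x)) (by
        rw [le_principal_iff]
        exact Ultrafilter.mem_map.2 (Eventually.of_forall fun l => by simpa using hbd l x))
    exact ⟨z, by simpa using hz, hUz⟩
  choose s hs1 hs2 using hex
  let σ₀ : A →ₗ[ℂ] ℂ :=
    { toFun := s
      map_add' := fun x y => tendsto_nhds_unique (hs2 (x + y))
        (((hs2 x).add (hs2 y)).congr fun l => by simp)
      map_smul' := fun c x => tendsto_nhds_unique (hs2 (c • x))
        (((hs2 x).const_mul c).congr fun l => by simp) }
  let σ : A →L[ℂ] ℂ := σ₀.mkContinuous 1 fun x => (hs1 x).trans (one_mul _).ge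
  have hσ : ∀ x, Tendsto (fun l => τ l (ψ l x)) (U : Filter Λ) (𝓝 (σ x)) := hs2
  have hself : ∀ y, σ (star y * y) = σ (y * star y) := by
    have hclosed : IsClosed {y : A | σ (star y * y) = σ (y * star y)} :=
      isClosed_eq (by fun_prop) (by fun_prop)
    intro y
    refine hclosed.closure_subset_iff.2 (fun _ h => h) (?_ : y ∈ closure _)
    rw [Metric.mem_closure_iff]
    intro ε hε
    obtain ⟨y', e, hy', he0, he1, h1, h2⟩ := exists_localUnit y (half_pos hε)
    refine ⟨y', ?_, by rw [dist_eq_norm]; linarith⟩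
    have := h.tendsto_trace_of_localUnit hτ hτn he0 he1 h1 h2
    exact sub_eq_zero.1 (tendsto_nhds_unique ((hσ _).sub (hσ _)) this)
  refine ⟨σ, ⟨fun x hx => ?_, fun x y => ?_⟩, hσ⟩
  · exact ge_of_tendsto (hσ x) (Eventually.of_forall fun l => hτ0 l _ ((h.schwarz l).nonneg x hx))
  · -- polarization
    have hpol : ∀ a b : A, σ (star a * b) = σ (b * star a) := by
      intro a b
      have p0 := hself (a + b)
      have p1 := hself (a + Complex.I • b)
      have pa := hself a
      have pb := hself b
      simp only [star_add, star_smul, add_mul, mul_add, map_add, smul_mul_assoc, mul_smul_comm,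
        map_smul, smul_eq_mul, Complex.star_def, Complex.conj_I] at p0 p1
      have q0 : σ (star a * b) + σ (star b * a) = σ (b * star a) + σ (a * star b) := by
        linear_combination p0 - pa - pb
      have q1 : Complex.I * (σ (star a * b) - σ (star b * a))
          = Complex.I * (σ (b * star a) - σ (a * star b)) := by
        linear_combination p1 - pa + (Complex.I * Complex.I) * pb
      have q2 := mul_left_cancel₀ Complex.I_ne_zero q1
      linear_combination (q0 + q2) / 2
    simpa using hpol (star x) y

end IsAsymptoticallyOrderZero

end Trace

/-! ### Nuclear dimension -/

section Approximation

variable {A : Type*} [NonUnitalCStarAlgebra A] [PartialOrder A] [StarOrderedRing A]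

/-- Linked minimal projections have images of equal norm under an order zero map. -/
lemma IsOrderZeroMap.norm_map_eq_of_linked {C : Type*} [NonUnitalCStarAlgebra C] [PartialOrder C]
    [StarOrderedRing C] {φ : C →ₗ[ℂ] A} {u : C} (h : IsOrderZeroMap φ u) {ι : Type*} [Fintype ι]
    {p : ι → C} (hp : IsMinimalPartition p u) {i j : ι} (hij : IsMinimalPartition.Linked p i j) :
    ‖φ (p i)‖ = ‖φ (p j)‖ := by
  obtain ⟨v, hv1, hv2⟩ := hp.exists_partialIsometry hij
  have hg : ∀ k, ‖φ (p k) * φ u‖ = ‖φ (p k)‖ ^ 2 := fun k => by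
    have hs : star (φ (p k)) = φ (p k) := by rw [← h.schwarz.map_star, hp.star_eq]
    have e : φ (p k) * φ (p k) = φ (p k) * φ u := by rw [h.map_mul (p k) (p k), hp.mul_self]
    rw [← e, norm_mul_self_of_selfAdjoint hs]
  have h1 : ‖φ (p j)‖ ^ 2 = ‖φ v‖ ^ 2 := by
    rw [← hg, ← hv1, ← h.map_mul, h.schwarz.map_star, CStarRing.norm_star_mul_self, sq]
  have h2 : ‖φ (p i)‖ ^ 2 = ‖φ v‖ ^ 2 := by
    rw [← hg, ← hv2, ← h.map_mul, h.schwarz.map_star, CStarRing.norm_self_mul_star, sq]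
  exact (pow_left_inj₀ (norm_nonneg _) (norm_nonneg _) two_ne_zero).1 (h2.trans h1.symm)

/-- Cutting down by a central projection preserves Schwarz maps. -/
lemma IsSchwarzMap.mulLeft_comp {C : Type*} [NonUnitalCStarAlgebra C] [PartialOrder C]
    [StarOrderedRing C] {ψ : A →ₗ[ℂ] C} (h : IsSchwarzMap ψ) {z : C} (hz : star z = z)
    (hzz : z * z = z) (hc : ∀ x, z * x = x * z) : IsSchwarzMap (LinearMap.mulLeft ℂ z ∘ₗ ψ) := by
  have hconj : ∀ x, z * x = star z * x * z := fun x => by rw [hz, mul_assoc, ← hc, ← mul_assoc, hzz]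
  refine ⟨fun x hx => ?_, fun x => ?_, fun x => ?_, fun x => ?_⟩
  · change 0 ≤ z * ψ x
    rw [hconj]
    exact star_left_conjugate_nonneg (h.nonneg x hx) z
  · change z * ψ (star x) = star (z * ψ x)
    rw [star_mul, hz, h.map_star, hc]
  · change ‖z * ψ x‖ ≤ ‖x‖
    refine (norm_mul_le _ _).trans ?_
    exact (mul_le_of_le_one_left (norm_nonneg _) (IsStarProjection.norm_le z ⟨hzz, hz⟩)).trans
      (h.norm_le x)
  · change star (z * ψ x) * (z * ψ x) ≤ z * ψ (star x * x)
    have e : star (z * ψ x) * (z * ψ x) = star z * (star (ψ x) * ψ x) * z := by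
      rw [← hconj, star_mul, hz]
      calc star (ψ x) * z * (z * ψ x) = star (ψ x) * (z * z) * ψ x := by noncomm_ring
        _ = z * star (ψ x) * ψ x := by rw [hzz, hc]
        _ = _ := mul_assoc _ _ _
    rw [e, hconj (ψ (star x * x))]
    exact star_left_conjugate_le_conjugate (h.star_mul_le x) z

/-- Orthogonal positive elements have asymptotically orthogonal images under maps that are
dominated by maps converging to the identity. -/
lemma tendsto_norm_mul_of_dominated {Λ : Type*} {F : Filter Λ} {θ : Λ → A → A}
    (hθ0 : ∀ l x, 0 ≤ x → 0 ≤ θ l x) (hθn : ∀ l x, ‖θ l x‖ ≤ ‖x‖)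
    (hdom : ∀ x, 0 ≤ x → ∃ X : Λ → A, Tendsto X F (𝓝 x) ∧ ∀ l, θ l x ≤ X l)
    {x y : A} (hx : 0 ≤ x) (hy : 0 ≤ y) (hxy : x * y = 0) :
    Tendsto (fun l => ‖θ l x * θ l y‖) F (𝓝 0) := by
  obtain ⟨X, hX, hxX⟩ := hdom x hx
  obtain ⟨Y, hY, hyY⟩ := hdom y hy
  have hyx : y * x = 0 := by
    have := congrArg star hxy
    rwa [star_mul, (IsSelfAdjoint.of_nonneg hx).star_eq, (IsSelfAdjoint.of_nonneg hy).star_eq,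
      star_zero] at this
  have hle : ∀ l, (‖θ l x * θ l y‖ ^ 2) ^ 2
      ≤ (‖x‖ * ‖y‖) ^ 2 * (‖y‖ * (‖X l‖ * ‖Y l * X l‖)) := by
    intro l
    have h1 := norm_mul_sq_le_of_le (hθ0 l x hx) (hxX l) (θ l y)
    have h2 := norm_mul_sq_le_of_le (hθ0 l y hy) (hyY l) (X l)
    have h3 : ‖X l * θ l y‖ = ‖θ l y * X l‖ := by
      rw [← norm_star, star_mul, (IsSelfAdjoint.of_nonneg (hθ0 l y hy)).star_eq,
        (IsSelfAdjoint.of_nonneg ((hθ0 l x hx).trans (hxX l))).star_eq]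
    calc (‖θ l x * θ l y‖ ^ 2) ^ 2 ≤ (‖θ l x‖ * (‖θ l y‖ * ‖X l * θ l y‖)) ^ 2 := by gcongr
      _ = (‖θ l x‖ * ‖θ l y‖) ^ 2 * ‖θ l y * X l‖ ^ 2 := by rw [h3]; ring
      _ ≤ (‖x‖ * ‖y‖) ^ 2 * (‖y‖ * (‖X l‖ * ‖Y l * X l‖)) := by
          gcongr
          · exact hθn l x
          · exact hθn l y
          · exact h2.trans (by gcongr; exact hθn l y)
  have h4 : Tendsto (fun l => (‖θ l x * θ l y‖ ^ 2) ^ 2) F (𝓝 0) := by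
    refine squeeze_zero (fun l => by positivity) hle ?_
    have := ((hX.norm.mul (hY.mul hX).norm).const_mul ‖y‖).const_mul ((‖x‖ * ‖y‖) ^ 2)
    simpa [hyx] using this
  have h5 := h4.sqrt.sqrt
  simpa [Real.sqrt_sq, norm_nonneg] using h5

variable {Λ : Type*} {F : Filter Λ} {C : Λ → FinDimCStarAlgebra} {ψ : ∀ l, A →CP C l}
  {φ : ∀ l, C l →CP A}

/-- On the simple summands that `φ` does not nearly annihilate, the traces of `ψ a` tend to zero
if all bounded traces vanish at `a`: otherwise, `ψ` being asymptotically of order zero into these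
summands, a limit of the traces pulled back along `ψ` would be a bounded trace not vanishing at
`a`. -/
lemma eventually_norm_blockTrace_le (hψ : ∀ l, (ψ l).IsContractive) (hφ : ∀ l, (φ l).IsOrderZero)
    (hdom : ∀ x, 0 ≤ x → ∃ X : Λ → A, Tendsto X F (𝓝 x) ∧ ∀ l, φ l (ψ l x) ≤ X l)
    {a : A} (ha : a ∈ tracialKernel A) {ε δ : ℝ} (hε : 0 < ε) (hδ : 0 < δ) :
    ∀ᶠ l in F, ∀ (u : C l), star u = u → (∀ x, u * x = x) → (∀ x, x * u = x) →
      ∀ (ι : Type) (_ : Fintype ι) (p : ι → C l) (hp : IsMinimalPartition p u) (i : ι),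
        (∀ j ∈ IsMinimalPartition.block p i, ε ≤ ‖φ l (p j)‖) →
        ‖hp.blockTrace i (ψ l a)‖ ≤ δ := by
  by_contra hcon
  rw [not_eventually] at hcon
  set S : Set Λ := {l | ¬ ∀ (u : C l), star u = u → (∀ x, u * x = x) → (∀ x, x * u = x) →
      ∀ (ι : Type) (_ : Fintype ι) (p : ι → C l) (hp : IsMinimalPartition p u) (i : ι),
        (∀ j ∈ IsMinimalPartition.block p i, ε ≤ ‖φ l (p j)‖) →
        ‖hp.blockTrace i (ψ l a)‖ ≤ δ} with hS
  have hne : (F.comap (Subtype.val : S → Λ)).NeBot := by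
    rw [comap_neBot_iff_frequently]
    exact hcon.mono fun l hl => ⟨⟨l, hl⟩, rfl⟩
  let U : Ultrafilter S := Ultrafilter.of (F.comap (Subtype.val : S → Λ))
  have hU : Tendsto (Subtype.val : S → Λ) (U : Filter S) F :=
    tendsto_comap.mono_left (Ultrafilter.of_le _)
  have hSl : ∀ l : S, ∃ (u : C l), star u = u ∧ (∀ x, u * x = x) ∧ (∀ x, x * u = x) ∧
      ∃ (ι : Type) (_ : Fintype ι) (p : ι → C l) (hp : IsMinimalPartition p u) (i : ι),
        (∀ j ∈ IsMinimalPartition.block p i, ε ≤ ‖φ l (p j)‖) ∧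
        δ < ‖hp.blockTrace i (ψ l a)‖ := by
    rintro ⟨l, hl⟩
    rw [hS, Set.mem_ofPred_eq] at hl
    push Not at hl
    exact hl
  choose u hu hu1 hu2 ι hι p hp i hi hδi using hSl
  let z : ∀ l : S, C l := fun l => IsMinimalPartition.blockUnit (p l) (i l)
  let ψ' : ∀ l : S, A →ₗ[ℂ] C l := fun l => LinearMap.mulLeft ℂ (z l) ∘ₗ (ψ l : A →ₗ[ℂ] C l)
  have hzs : ∀ l, star (z l) = z l := fun l => (hp l).star_sum _
  have hzz : ∀ l, z l * z l = z l := fun l => (hp l).sum_mul_sum (Finset.Subset.refl _)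
  have hzc : ∀ l x, z l * x = x * z l := fun l x => (hp l).blockUnit_mul (hu1 l) (i l) x
  have hψS : ∀ l, IsSchwarzMap (ψ l : A →ₗ[ℂ] C l) := fun l => (hψ l).isSchwarzMap
  have hφO : ∀ l : S, IsOrderZeroMap (φ l : C l →ₗ[ℂ] A) (u l) := fun l =>
    (hφ l).isOrderZeroMap (hu l) (hu1 l) (hu2 l)
  have hasymp : IsAsymptoticallyOrderZero (U : Filter S) ψ' := by
    refine ⟨fun l => (hψS l).mulLeft_comp (hzs l) (hzz l) (hzc l), fun x y hx hy hxy => ?_⟩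
    have hθ := (tendsto_norm_mul_of_dominated (F := F) (θ := fun l x => φ l (ψ l x))
      (fun l x hx => map_nonneg (φ l) (map_nonneg (ψ l) hx))
      (fun l x => ((hφ l).1 _).trans (hψ l x)) hdom hx hy hxy).comp hU
    refine squeeze_zero (fun _ => norm_nonneg _) (fun l => ?_)
      (by simpa using hθ.const_mul (ε ^ 3)⁻¹)
    have e : ψ' l x * ψ' l y = z l * (ψ l x * ψ l y) := by
      change z l * ψ l x * (z l * ψ l y) = _
      calc z l * ψ l x * (z l * ψ l y) = z l * (ψ l x * z l) * ψ l y := by noncomm_ring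
        _ = (z l * z l) * ψ l x * ψ l y := by rw [← hzc]; noncomm_ring
        _ = _ := by rw [hzz, mul_assoc]
    rw [e, ← div_eq_inv_mul, le_div_iff₀ (by positivity), mul_comm]
    exact (hφO l).norm_blockUnit_mul_le (hp l) hε (hi l) (ψ l x) (ψ l y)
  obtain ⟨σ, hσ, hlim⟩ := hasymp.exists_isBoundedTrace (τ := fun l => (hp l).blockTrace (i l))
    (fun l => (hp l).blockTrace_mul_comm (hu1 l) (i l)) (fun l => (hp l).norm_blockTrace_le (i l))
    (fun l x hx => (hp l).blockTrace_nonneg (i l) hx)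
  have h0 := (hlim a).norm
  rw [ha.2 σ hσ, norm_zero] at h0
  obtain ⟨l, hl⟩ := (h0.eventually (gt_mem_nhds hδ)).exists
  have e : (hp l).blockTrace (i l) (ψ' l a) = (hp l).blockTrace (i l) (ψ l a) :=
    (hp l).blockTrace_blockUnit_mul (i l) (ψ l a)
  rw [e] at hl
  exact (hδi l).not_gt hl

/-- For one of the summands `φ ∘ ψ` of an approximation of the identity, the image of an element
that vanishes on bounded traces is nearly a self-commutator. -/
lemma eventually_exists_selfCommutator (hψ : ∀ l, (ψ l).IsContractive)
    (hφ : ∀ l, (φ l).IsOrderZero)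
    (hdom : ∀ x, 0 ≤ x → ∃ X : Λ → A, Tendsto X F (𝓝 x) ∧ ∀ l, φ l (ψ l x) ≤ X l)
    {a : A} (ha : a ∈ tracialKernel A) {γ : ℝ} (hγ : 0 < γ) :
    ∀ᶠ l in F, ∃ y : A, ‖y‖ ^ 2 ≤ 2 * (‖a‖ + γ) ∧
      ‖φ l (ψ l a) - (star y * y - y * star y)‖ ≤ γ := by
  classical
  obtain ⟨ε, hε, hεa⟩ : ∃ ε : ℝ, 0 < ε ∧ ‖a‖ ^ 2 * ε ≤ (γ / 2) ^ 2 := by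
    refine ⟨(γ / 2) ^ 2 / (‖a‖ ^ 2 + 1), by positivity, ?_⟩
    rw [mul_div_assoc', div_le_iff₀ (by positivity)]
    nlinarith [sq_nonneg (γ / 2)]
  filter_upwards [eventually_norm_blockTrace_le hψ hφ hdom ha hε (half_pos hγ)] with l hl
  obtain ⟨u, hu, hu1, hu2⟩ := exists_unit_of_finiteDimensional (C l)
  have hS : IsSchwarzMap (ψ l : A →ₗ[ℂ] C l) := (hψ l).isSchwarzMap
  have hO : IsOrderZeroMap (φ l : C l →ₗ[ℂ] A) u := (hφ l).isOrderZeroMap hu hu1 hu2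
  have hcs : star (ψ l a) = ψ l a := by
    have := hS.map_star a
    rw [ha.1.star_eq] at this
    exact this.symm
  obtain ⟨ι, _, p, lam, hp, hc⟩ := exists_isMinimalPartition_corner _ u (ψ l a) hu (hu1 u) hcs
    (hu1 _) (hu2 _) rfl
  have hlam : ∀ j, |lam j| ≤ ‖a‖ := fun j => by
    have h1 := hp.norm_coeff_le j (ψ l a)
    rw [hc, hp.coeff_sum_smul, ← hc, Complex.norm_real] at h1
    exact h1.trans (hψ l a)
  let avg : ι → ℝ := fun i => ((IsMinimalPartition.block p i).card : ℝ)⁻¹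
    * ∑ j ∈ IsMinimalPartition.block p i, lam j
  have havg : ∀ i, hp.blockTrace i (ψ l a) = (avg i : ℂ) := fun i => by
    rw [hp.blockTrace_apply, hc]
    simp only [hp.coeff_sum_smul, avg]
    push_cast
    rfl
  let good : ι → Prop := fun i => ∀ j ∈ IsMinimalPartition.block p i, ε ≤ ‖φ l (p j)‖
  have hgood : ∀ i, good i → |avg i| ≤ γ / 2 := fun i hi => by
    have := hl u hu hu1 hu2 ι _ p hp i hi
    rwa [havg, Complex.norm_real] at this
  -- subtract the traces on the summands which `φ` does not nearly annihilate, and drop the others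
  let μ : ι → ℝ := fun i => if good i then lam i - avg i else 0
  have hμ : ∀ j, |μ j| ≤ ‖a‖ + γ := fun j => by
    by_cases hj : good j
    · simp only [μ, if_pos hj]
      exact (abs_sub _ _).trans (by linarith [hlam j, hgood j hj])
    · simp only [μ, if_neg hj, abs_zero]; positivity
  have hsum : ∀ i, ∑ j ∈ IsMinimalPartition.block p i, μ j = 0 := by
    intro i
    have hblk : ∀ j ∈ IsMinimalPartition.block p i,
        μ j = if good i then lam j - avg i else 0 := by
      intro j hj
      simp only [μ, good, avg, hp.block_eq hj]
    rw [Finset.sum_congr rfl hblk]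
    by_cases hi : good i
    · have hn : ((IsMinimalPartition.block p i).card : ℝ) ≠ 0 := by
        exact_mod_cast (hp.card_block_pos i).ne'
      simp only [if_pos hi, Finset.sum_sub_distrib, Finset.sum_const, nsmul_eq_mul, avg]
      field_simp
      simp
    · simp [if_neg hi]
  obtain ⟨x, hx1, hx2⟩ := hp.exists_selfCommutator (by positivity) hμ hsum
  obtain ⟨y, hy1, hy2⟩ := hO.exists_selfCommutator x (half_pos hγ)
  refine ⟨y, hy1.trans hx2, ?_⟩
  have hdiff : ‖φ l (∑ i, (lam i - μ i) • p i)‖ ≤ γ / 2 := by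
    refine le_of_sq_le_sq ?_ (by positivity)
    refine hO.norm_map_diagonal_sq_le hp (fun i => ?_) (sq_nonneg _)
    by_cases hi : good i
    · have e : lam i - μ i = avg i := by simp only [μ, if_pos hi]; ring
      rw [e]
      have h1 : ‖φ l (p i)‖ ≤ 1 := ((hφ l).1 _).trans (hp.norm_eq_one i).le
      calc avg i ^ 2 * ‖φ l (p i)‖ ≤ avg i ^ 2 * 1 := by gcongr
        _ = |avg i| ^ 2 := by rw [sq_abs, mul_one]
        _ ≤ _ := by gcongr; exact hgood i hi
    · have e : lam i - μ i = lam i := by simp only [μ, if_neg hi]; ring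
      rw [e]
      have hi' := hi
      simp only [good] at hi'
      push Not at hi'
      obtain ⟨j, hj, hjε⟩ := hi'
      have h1 : ‖φ l (p i)‖ = ‖φ l (p j)‖ :=
        hO.norm_map_eq_of_linked hp (IsMinimalPartition.mem_block.1 hj)
      refine le_trans ?_ hεa
      calc lam i ^ 2 * ‖φ l (p i)‖ = |lam i| ^ 2 * ‖φ l (p j)‖ := by rw [h1, sq_abs]
        _ ≤ ‖a‖ ^ 2 * ε := by
            gcongr
            exact hlam i
  have hy2' : ‖φ l (star x * x - x * star x) - (star y * y - y * star y)‖ ≤ γ / 2 := hy2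
  have hsplit : φ l (ψ l a) = φ l (∑ i, (lam i - μ i) • p i) + φ l (star x * x - x * star x) := by
    rw [hx1, ← map_add, ← Finset.sum_add_distrib]
    congr 1
    rw [hc]
    refine Finset.sum_congr rfl fun i _ => ?_
    rw [← add_smul, sub_add_cancel]
  rw [hsplit, add_sub_assoc]
  exact (norm_add_le _ _).trans (by linarith)

end Approximation

lemma hasNuclearDimensionAtMost_of_eq {A : Type*} [NonUnitalCStarAlgebra A] [PartialOrder A]
    [StarOrderedRing A] {m : ℕ} (hm : nuclearDimension A = m) : HasNuclearDimensionAtMost A m := by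
  have hne : {d : ℕ∞ | ∃ m : ℕ, d = m ∧ HasNuclearDimensionAtMost A m}.Nonempty := by
    by_contra hcon
    rw [Set.not_nonempty_iff_eq_empty] at hcon
    rw [nuclearDimension, hcon, sInf_empty] at hm
    exact ENat.top_ne_natCast m hm
  obtain ⟨k, hk, hA⟩ := csInf_mem hne
  have : (m : ℕ∞) = k := hm.symm.trans hk
  rwa [Nat.cast_inj.1 this]

theorem theorem1p1 {A : Type*} [NonUnitalCStarAlgebra A] [PartialOrder A] [StarOrderedRing A]
    (m : ℕ) (hm : nuclearDimension A = m) (a : A) (ha : a ∈ tracialKernel A) :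
    a ∈ closure {s : A | ∃ x : Fin (m + 1) → A,
      (∀ k, ‖x k‖ ^ 2 ≤ 2 * ‖a‖) ∧
      s = ∑ k, (star (x k) * x k - x k * star (x k))} := by
  by_cases ha0 : a = 0
  · exact subset_closure ⟨fun _ => 0, by simp, by simp [ha0]⟩
  have hapos : 0 < ‖a‖ := norm_pos_iff.2 ha0
  obtain ⟨Λ, _, _, _, C, ψ, φ, hψ, hφ, hlim⟩ := hasNuclearDimensionAtMost_of_eq hm
  rw [Metric.mem_closure_iff]
  intro ε hε
  obtain ⟨γ, hγ, hγε⟩ : ∃ γ : ℝ, 0 < γ ∧ (m + 1) * (5 * γ) ≤ ε / 2 := by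
    refine ⟨ε / (10 * (m + 1)), by positivity, le_of_eq ?_⟩
    field_simp
    norm_num
  have hk : ∀ k, ∀ᶠ l in atTop, ∃ y : A, ‖y‖ ^ 2 ≤ 2 * (‖a‖ + γ) ∧
      ‖φ k l (ψ k l a) - (star y * y - y * star y)‖ ≤ γ := fun k =>
    eventually_exists_selfCommutator (hψ k) (hφ k)
      (fun x hx => ⟨_, hlim x, fun l => Finset.single_le_sum (f := fun k => φ k l (ψ k l x))
        (fun j _ => map_nonneg (φ j l) (map_nonneg (ψ j l) hx)) (Finset.mem_univ k)⟩) ha hγ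
  obtain ⟨l, hl, hla⟩ := ((eventually_all.2 hk).and
    ((tendsto_iff_norm_sub_tendsto_zero.1 (hlim a)).eventually (gt_mem_nhds (half_pos hε)))).exists
  choose y hy1 hy2 using hl
  -- rescale to meet the norm bound exactly
  set r := ‖a‖ / (‖a‖ + γ) with hr
  have hr0 : 0 ≤ r := by positivity
  have hsq : √r * √r = r := Real.mul_self_sqrt hr0
  have hcomm : ∀ k, star (√r • y k) * (√r • y k) - (√r • y k) * star (√r • y k)
      = r • (star (y k) * y k - y k * star (y k)) := fun k => by
    rw [star_smul, smul_mul_smul_comm, smul_mul_smul_comm, star_trivial, hsq, smul_sub]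
  refine ⟨_, ⟨fun k => √r • y k, fun k => ?_, rfl⟩, ?_⟩
  · rw [norm_smul, mul_pow, Real.norm_of_nonneg (Real.sqrt_nonneg _), Real.sq_sqrt hr0]
    calc r * ‖y k‖ ^ 2 ≤ r * (2 * (‖a‖ + γ)) := by gcongr; exact hy1 k
      _ = 2 * ‖a‖ := by rw [hr]; field_simp
  · simp only [hcomm]
    have hterm : ∀ k, ‖φ k l (ψ k l a) - r • (star (y k) * y k - y k * star (y k))‖ ≤ 5 * γ := by
      intro k
      set c := star (y k) * y k - y k * star (y k) with hc
      have hcn : ‖c‖ ≤ 4 * (‖a‖ + γ) := by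
        refine (norm_sub_le _ _).trans ?_
        rw [CStarRing.norm_star_mul_self, CStarRing.norm_self_mul_star]
        nlinarith [hy1 k]
      have h1r : (1 - r) * (‖a‖ + γ) = γ := by rw [hr]; field_simp; ring
      have h1r0 : 0 ≤ 1 - r := by
        rw [hr, sub_nonneg, div_le_one (by positivity)]; linarith
      calc ‖φ k l (ψ k l a) - r • c‖ = ‖(φ k l (ψ k l a) - c) + (1 - r) • c‖ := by
            congr 1; rw [sub_smul, one_smul]; abel
        _ ≤ γ + (1 - r) * (4 * (‖a‖ + γ)) := by
            refine (norm_add_le _ _).trans (add_le_add (hy2 k) ?_)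
            rw [norm_smul, Real.norm_of_nonneg h1r0]
            gcongr
        _ = γ + 4 * ((1 - r) * (‖a‖ + γ)) := by ring
        _ = 5 * γ := by rw [h1r]; ring
    rw [dist_eq_norm]
    calc ‖a - ∑ k, r • (star (y k) * y k - y k * star (y k))‖
        = ‖∑ k, (φ k l (ψ k l a) - r • (star (y k) * y k - y k * star (y k)))
            - (∑ k, φ k l (ψ k l a) - a)‖ := by
          congr 1; rw [Finset.sum_sub_distrib]; abel
      _ ≤ ∑ k, ‖φ k l (ψ k l a) - r • (star (y k) * y k - y k * star (y k))‖
            + ‖∑ k, φ k l (ψ k l a) - a‖ :=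
          (norm_sub_le _ _).trans (by gcongr; exact norm_sum_le _ _)
      _ ≤ ∑ _k : Fin (m + 1), 5 * γ + ‖∑ k, φ k l (ψ k l a) - a‖ := by
          gcongr with k _
          exact hterm k
      _ < (m + 1) * (5 * γ) + ε / 2 := by
          simp only [Finset.sum_const, Finset.card_univ, Fintype.card_fin, nsmul_eq_mul]
          push_cast
          linarith
      _ ≤ ε := by linarith
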